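/- **Setting.** Let $(X,d)$ be a compact connected metric space with more than one point and let $\mu$ be a finite Borel measure on $X$ with $\mu(B_r(x))>0$ for all $x\in X$, $r>0$. Here $B_r(x)$ is the open and $B_r[x]$ the closed ball. All $L^2$ spaces are real. Write $v_r(x)=\mu(B_r(x))$. *Discrete walk.* For $r>0$ put $$a_r(x)=\frac1{v_r(x)}\int_{B_r(x)}\Big(1+\frac{v_r(x)}{v_r(y)}\Big)d\mu(y),\qquad w_r(x,y)=\frac{\chi_{B_r(x)}(y)}{a_r(x)v_r(x)}\Big(1+\frac{v_r(x)}{v_r(y)}\Big),\qquad d\nu_r=a_r\,d\mu .$$ For a closed ball $B$ let $E_{r,B}(x)\in[0,\infty]$ be the expected first exit time from $B$ (number of steps) of the discrete time Markov chain on $X$ started at $x$ with transition density $w_r$ with respect to $\mu$, let $E^+_{r,B}=\sup_{y\in B}E_{r,B}(y)$, and let $W_r^Bf(x)=\int_Bw_r(x,y)f(y)\,d\mu(y)$ on $L^2(B,\nu_r)$. *Local time exponent.* Let $\beta(B)=\sup\{\gamma\ge0:\limsup_{r\to0^+}r^\gamma E^+_{r,B}=\infty\}$ (with $\sup\emptyset=0$)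 and $\beta(x)=\inf_{R>0}\beta(B_R[x])\in[0,\infty]$. *Walk with renormalised time.* If $\beta$ is finite, put $\tau_r(x)=r^{\beta(x)}$, $d_r(x)=v_r(x)\tau_r(x)$, $$q_r(x)=\frac1{v_r(x)}\int_{B_r(x)}\Big(1+\frac{d_r(x)}{d_r(y)}\Big)d\mu(y),\qquad p_r(x,y)=\frac{\chi_{B_r(x)}(y)}{q_r(x)v_r(x)}\Big(1+\frac{d_r(x)}{d_r(y)}\Big),\qquad d\mu_r=q_r\,d\mu .$$ Let $\phi_{r,B}(x)$ be the expected first exit time from $B$ of the continuous time pure jump process started at $x$ which at a point $z$ waits an exponentially distributed time of mean $\tau_r(z)$ and then jumps with density $p_r(z,\cdot)$ with respect to $\mu$, let $\phi^+_{r,B}=\sup_{y\in B}\phi_{r,B}(y)$, and let $$\mathscr L_r^Bf(x)=r^{-\beta(x)}\Big(f(x)-\int_Bp_r(x,y)f(y)\,d\mu(y)\Big)\quad\text{on }L^2(B,\mu_r).$$ Condition $(E_\beta)$: $\beta(x)<\infty$ for all $x$, and there is $C>0$ such that $C^{-1}R^{\beta(x)}\le\limsup_{r\to0^+}\phi^+_{r,B_R[x]}\le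 CR^{\beta(x)}$ for all $x\in X$ and $0<R<\operatorname{diam}(X)/2$. **Theorem (Faber–Krahn inequality).** 1. There are $r_0>0$ and $c>0$ such that for all $x_0\in X$, $0<R<\operatorname{diam}(X)/2$ and $0<r<r_0$, with $B=B_R[x_0]$, the bottom $\sigma_r^B$ of the spectrum of $I-W_r^B$ on $L^2(B,\nu_r)$ satisfies $\sigma_r^B\ge c/E^+_{r,B}$ (where $c/\infty=0$). 2. Suppose $(E_\beta)$ holds. Then there is $c>0$ such that for all $x_0\in X$ and $0<R<\operatorname{diam}(X)/2$ there is $r_0>0$ such that, for $0<r<r_0$ and $B=B_R[x_0]$, the bottom $\lambda_r^B$ of the spectrum of $\mathscr L_r^B$ on $L^2(B,\mu_r)$ satisfies $\lambda_r^B\ge c\,R^{-\beta(x_0)}$. The constant $c$ does not depend on $r$, $R$ or $x_0$. -/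

import Mathlib

open MeasureTheory ProbabilityTheory Filter Topology Set
open scoped ENNReal NNReal

namespace LocalWalk

/-! ## Markov chains and their exit times -/

section Chains

variable {S : Type*} [MeasurableSpace S]

open Classical in
/-- The kernel `κ` if it is a Markov kernel, and the identity kernel otherwise.  The kernels to
which this is applied below are Markov, see `isMarkovKernel_jump` and `isMarkovKernel_holdJump`. -/
noncomputable def markovPart (κ : Kernel S S) : Kernel S S :=
  if IsMarkovKernel κ then κ else Kernel.id

instance isMarkovKernel_markovPart (κ : Kernel S S) : IsMarkovKernel (markovPart κ) := by
  unfold markovPart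
  split_ifs with h
  · exact h
  · infer_instance

theorem markovPart_eq (κ : Kernel S S) [h : IsMarkovKernel κ] : markovPart κ = κ := if_pos h

/-- The law on `S^ℕ` of the time-homogeneous Markov chain with transition kernel `κ` started
at `s`. -/
noncomputable def pathLaw (κ : Kernel S S) [IsMarkovKernel κ] (s : S) : Measure (ℕ → S) :=
  Kernel.traj (X := fun _ => S)
    (fun n => κ.comap (fun h : (i : Finset.Iic n) → S => h ⟨n, Finset.mem_Iic.2 le_rfl⟩)
      (measurable_pi_apply _)) 0 (fun _ => s)

/-- The first exit time `inf {k ≥ 0 | ω k ∉ B}` of a discrete path, with `inf ∅ = ∞`. -/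
noncomputable def exitStep (B : Set S) (ω : ℕ → S) : ℝ≥0∞ :=
  ⨅ (k : ℕ) (_ : ω k ∉ B), (k : ℝ≥0∞)

/-- The state at time `t` of the pure jump path described by `ω`, where `(ω k).2` is the `k`-th
state and `(ω k).1`, for `k ≥ 1`, is the waiting time before the `k`-th jump: the state is `(ω n).2`
for `n = sup {k | ∑_{j=1}^k (ω j).1 ≤ t}`. -/
noncomputable def position (ω : ℕ → ℝ × S) (t : ℝ≥0) : S :=
  (ω (sSup {k : ℕ | ∑ j ∈ Finset.Icc 1 k, (ω j).1 ≤ (t : ℝ)})).2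

/-- The first exit time `inf {t ≥ 0 | x_t ∉ B}` of a pure jump path. -/
noncomputable def exitTime (B : Set S) (ω : ℕ → ℝ × S) : ℝ≥0∞ :=
  ⨅ (t : ℝ≥0) (_ : position ω t ∉ B), (t : ℝ≥0∞)

end Chains

/-! ## Partially symmetrised walks -/

section Walks

variable {X : Type*} [MetricSpace X] [MeasurableSpace X]

/-- `v_r(x) = μ(B_r(x))`, with `B_r(x)` the open ball. -/
noncomputable def vol (μ : Measure X) (r : ℝ) (x : X) : ℝ := μ.real (Metric.ball x r)

/-- `(1 / μ(B_r(x))) ∫_{B_r(x)} (1 + d(x) / d(y)) dμ(y)`. -/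
noncomputable def symNorm (μ : Measure X) (r : ℝ) (d : X → ℝ) (x : X) : ℝ :=
  (vol μ r x)⁻¹ * ∫ y in Metric.ball x r, (1 + d x / d y) ∂μ

/-- The transition density, with respect to `μ`, of the walk that jumps from `x` into `B_r(x)` with
density proportional to `1 + d(x) / d(y)`. -/
noncomputable def symDensity (μ : Measure X) (r : ℝ) (d : X → ℝ) (x y : X) : ℝ :=
  (symNorm μ r d x)⁻¹ * (vol μ r x)⁻¹ * (Metric.ball x r).indicator (fun y => 1 + d x / d y) y

/-- The jump kernel with density `symDensity μ r d`. -/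
noncomputable def jumpKernel (μ : Measure X) [SFinite μ] (r : ℝ) (d : X → ℝ) : Kernel X X :=
  Kernel.withDensity (Kernel.const X μ) (fun x y => ENNReal.ofReal (symDensity μ r d x y))

/-- The kernel on `ℝ × X` of the walk with waiting times: at `x` wait an exponential time of mean
`τ x`, then jump with density `symDensity μ r d x`. -/
noncomputable def holdJumpKernel (μ : Measure X) [SFinite μ] (r : ℝ) (d τ : X → ℝ) :
    Kernel (ℝ × X) (ℝ × X) :=
  Kernel.withDensity (Kernel.const (ℝ × X) ((volume : Measure ℝ).prod μ))
    (fun s z => exponentialPDF (τ s.2)⁻¹ z.1 * ENNReal.ofReal (symDensity μ r d s.2 z.2))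

variable (μ : Measure X) [SFinite μ]

/-! ### The discrete time walk and the local time exponent -/

/-- `a_r`. -/
noncomputable def aFactor (r : ℝ) (x : X) : ℝ := symNorm μ r (vol μ r) x

/-- `w_r(x, y)`. -/
noncomputable def wDensity (r : ℝ) (x y : X) : ℝ := symDensity μ r (vol μ r) x y

/-- `E_{r,B}(x)`: the mean number of steps to leave `B` of the walk with transition density `w_r`
started at `x`. -/
noncomputable def meanExitSteps (r : ℝ) (B : Set X) (x : X) : ℝ≥0∞ :=
  ∫⁻ ω, exitStep B ω ∂(pathLaw (markovPart (jumpKernel μ r (vol μ r))) x)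

/-- `E⁺_{r,B} = sup_{y ∈ B} E_{r,B}(y)`. -/
noncomputable def maxExitSteps (r : ℝ) (B : Set X) : ℝ≥0∞ := ⨆ y ∈ B, meanExitSteps μ r B y

/-- `T_γ(B) = limsup_{r → 0⁺} E⁺_{r,B} r^γ`. -/
noncomputable def scaledExitSteps (γ : ℝ≥0) (B : Set X) : ℝ≥0∞ :=
  limsup (fun r : ℝ => maxExitSteps μ r B * ENNReal.ofReal (r ^ (γ : ℝ))) (𝓝[>] 0)

/-- `β(B) = sup {γ | T_γ(B) = ∞} ∈ [0, ∞]`. -/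
noncomputable def setExponent (B : Set X) : ℝ≥0∞ :=
  ⨆ (γ : ℝ≥0) (_ : scaledExitSteps μ γ B = ∞), (γ : ℝ≥0∞)

/-- The local time exponent `β(x) = inf_{R > 0} β(B_R[x]) ∈ [0, ∞]`, with `B_R[x]` the closed
ball. -/
noncomputable def timeExponent (x : X) : ℝ≥0∞ :=
  ⨅ (R : ℝ) (_ : 0 < R), setExponent μ (Metric.closedBall x R)

/-- `β(x)` as a real number; used where `β` is finite. -/
noncomputable def timeExponentReal (x : X) : ℝ := (timeExponent μ x).toReal

/-! ### The walk with renormalised time -/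

/-- `τ_r(x) = r^{β(x)}`. -/
noncomputable def waitingTime (r : ℝ) (x : X) : ℝ := r ^ timeExponentReal μ x

/-- `d_r(x) = v_r(x) τ_r(x)`. -/
noncomputable def dWeight (r : ℝ) (x : X) : ℝ := vol μ r x * waitingTime μ r x

/-- `q_r`. -/
noncomputable def qFactor (r : ℝ) (x : X) : ℝ := symNorm μ r (dWeight μ r) x

/-- `p_r(x, y)`. -/
noncomputable def pDensity (r : ℝ) (x y : X) : ℝ := symDensity μ r (dWeight μ r) x y

/-- `φ_{r,B}(x)`: the mean exit time from `B` of the continuous time walk started at `x`. -/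
noncomputable def meanExitTime (r : ℝ) (B : Set X) (x : X) : ℝ≥0∞ :=
  ∫⁻ ω, exitTime B ω
    ∂(pathLaw (markovPart (holdJumpKernel μ r (dWeight μ r) (waitingTime μ r))) (0, x))

/-- `φ⁺_{r,B} = sup_{y ∈ B} φ_{r,B}(y)`. -/
noncomputable def maxExitTime (r : ℝ) (B : Set X) : ℝ≥0∞ := ⨆ y ∈ B, meanExitTime μ r B y

/-- `limsup_{r → 0⁺} φ⁺_{r,B}`. -/
noncomputable def limitExitTime (B : Set X) : ℝ≥0∞ :=
  limsup (fun r : ℝ => maxExitTime μ r B) (𝓝[>] 0)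

/-- The time regularity condition `(E_β)`, for the local time exponent `β`, which is to be
finite. -/
def TimeRegular : Prop :=
  (∀ x, timeExponent μ x < ∞) ∧
  ∃ C : ℝ, 0 < C ∧ ∀ (x : X) (R : ℝ), 0 < R → R < Metric.diam (univ : Set X) / 2 →
    ENNReal.ofReal (C⁻¹ * R ^ timeExponentReal μ x) ≤ limitExitTime μ (Metric.closedBall x R) ∧
    limitExitTime μ (Metric.closedBall x R) ≤ ENNReal.ofReal (C * R ^ timeExponentReal μ x)

/-! ### Killed operators -/

/-- `ν_r`, with `dν_r = a_r dμ`. -/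
noncomputable def nuMeasure (r : ℝ) : Measure X :=
  μ.withDensity (fun x => ENNReal.ofReal (aFactor μ r x))

/-- `μ_r`, with `dμ_r = q_r dμ`. -/
noncomputable def muMeasure (r : ℝ) : Measure X :=
  μ.withDensity (fun x => ENNReal.ofReal (qFactor μ r x))

open Classical in
/-- The bounded operator on `L²(m)` given by the formula `A` (zero if there is none; for the two
formulas below see `killedWalk_ae` and `killedGenerator_ae`). -/
noncomputable def l2Operator (m : Measure X) (A : (X → ℝ) → X → ℝ) : Lp ℝ 2 m →L[ℝ] Lp ℝ 2 m :=
  if h : ∃ T : Lp ℝ 2 m →L[ℝ] Lp ℝ 2 m, ∀ f, T f =ᵐ[m] A f then h.choose else 0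

/-- `W_r^B f(x) = ∫_B w_r(x, y) f(y) dμ(y)` on `L²(B, ν_r)`. -/
noncomputable def killedWalk (r : ℝ) (B : Set X) :
    Lp ℝ 2 ((nuMeasure μ r).restrict B) →L[ℝ] Lp ℝ 2 ((nuMeasure μ r).restrict B) :=
  l2Operator _ (fun f x => ∫ y in B, wDensity μ r x y * f y ∂μ)

/-- `𝓛_r^B f(x) = r^{-β(x)} (f(x) - ∫_B p_r(x, y) f(y) dμ(y))` on `L²(B, μ_r)`. -/
noncomputable def killedGenerator (r : ℝ) (B : Set X) :
    Lp ℝ 2 ((muMeasure μ r).restrict B) →L[ℝ] Lp ℝ 2 ((muMeasure μ r).restrict B) :=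
  l2Operator _ (fun f x => (waitingTime μ r x)⁻¹ * (f x - ∫ y in B, pDensity μ r x y * f y ∂μ))

end Walks

/-! ### The kernels are Markov and the operators exist -/

section Facts

set_option linter.unusedSectionVars false

variable {X : Type*} [MetricSpace X] [CompactSpace X] [MeasurableSpace X] [BorelSpace X]

/-- Measurable, bounded, and bounded away from zero. -/
structure Regular (d : X → ℝ) : Prop where
  measurable : Measurable d
  bounds : ∃ c C : ℝ, 0 < c ∧ ∀ x, c ≤ d x ∧ d x ≤ C

theorem Regular.pos {d : X → ℝ} (h : Regular d) (x : X) : 0 < d x := by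
  obtain ⟨c, C, hc, hd⟩ := h.bounds
  exact hc.trans_le (hd x).1

theorem Regular.mul {d e : X → ℝ} (hd : Regular d) (he : Regular e) :
    Regular (fun x => d x * e x) := by
  obtain ⟨c, C, hc, h⟩ := hd.bounds
  obtain ⟨c', C', hc', h'⟩ := he.bounds
  refine ⟨hd.measurable.mul he.measurable, c * c', C * C', mul_pos hc hc', fun x => ⟨?_, ?_⟩⟩
  · exact mul_le_mul (h x).1 (h' x).1 hc'.le (hd.pos x).le
  · exact mul_le_mul (h x).2 (h' x).2 (he.pos x).le ((hd.pos x).le.trans (h x).2)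

theorem Regular.inv {d : X → ℝ} (hd : Regular d) : Regular (fun x => (d x)⁻¹) := by
  obtain ⟨c, C, hc, h⟩ := hd.bounds
  rcases isEmpty_or_nonempty X with hX | ⟨⟨x₀⟩⟩
  · exact ⟨hd.measurable.inv, 1, 1, one_pos, fun x => hX.elim x⟩
  · have hC : 0 < C := (hd.pos x₀).trans_le (h x₀).2
    refine ⟨hd.measurable.inv, C⁻¹, c⁻¹, inv_pos.2 hC, fun x => ⟨?_, ?_⟩⟩
    · exact inv_anti₀ (hd.pos x) (h x).2
    · exact inv_anti₀ hc (h x).1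

theorem measurableSet_near (r : ℝ) : MeasurableSet {p : X × X | p.2 ∈ Metric.ball p.1 r} :=
  measurableSet_lt (measurable_snd.dist measurable_fst) measurable_const

variable (μ : Measure X) [IsFiniteMeasure μ]

theorem regular_vol [μ.IsOpenPosMeasure] {r : ℝ} (hr : 0 < r) : Regular (vol μ r) := by
  refine ⟨?_, ?_⟩
  · exact (measurable_measure_prodMk_left (ν := μ) (measurableSet_near (X := X) r)).ennreal_toReal
  · rcases isEmpty_or_nonempty X with hX | ⟨⟨x₀⟩⟩
    · exact ⟨1, 1, one_pos, fun x => hX.elim x⟩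
    obtain ⟨t, -, htf, ht⟩ :=
      Metric.finite_approx_of_totallyBounded (isCompact_univ (X := X)).totallyBounded (r / 2)
        (half_pos hr)
    have htn : t.Nonempty := by
      obtain ⟨y, hy, -⟩ := mem_iUnion₂.1 (ht (mem_univ x₀))
      exact ⟨y, hy⟩
    obtain ⟨z, hz, hmin⟩ := Set.exists_min_image t (fun y => vol μ (r / 2) y) htf htn
    refine ⟨vol μ (r / 2) z, μ.real univ, ?_, fun x => ⟨?_, measureReal_mono (subset_univ _)⟩⟩
    · exact ENNReal.toReal_pos (Metric.measure_ball_pos μ z (half_pos hr)).ne'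
        (measure_ne_top _ _)
    · obtain ⟨y, hy, hxy⟩ := mem_iUnion₂.1 (ht (mem_univ x))
      refine (hmin y hy).trans (measureReal_mono ?_)
      intro w hw
      rw [Metric.mem_ball] at hw hxy ⊢
      have := dist_triangle_right w x y
      linarith

/-- Joint measurability of the unnormalised jump density. -/
theorem measurable_near {d : X → ℝ} (hd : Measurable d) (r : ℝ) :
    Measurable (fun p : X × X => (Metric.ball p.1 r).indicator (fun y => 1 + d p.1 / d y) p.2) := by
  have : (fun p : X × X => (Metric.ball p.1 r).indicator (fun y => 1 + d p.1 / d y) p.2) =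
      indicator {p : X × X | p.2 ∈ Metric.ball p.1 r} (fun p => 1 + d p.1 / d p.2) := by
    funext p
    rfl
  rw [this]
  exact (measurable_const.add ((hd.comp measurable_fst).div (hd.comp measurable_snd))).indicator
    (measurableSet_near r)

theorem Regular.ratio {d : X → ℝ} (hd : Regular d) :
    ∃ C : ℝ, 0 ≤ C ∧ ∀ x y, 0 ≤ d x / d y ∧ d x / d y ≤ C := by
  obtain ⟨C, hC⟩ := (hd.inv).bounds.choose_spec
  obtain ⟨C', hC'⟩ := hd.bounds.choose_spec
  rcases isEmpty_or_nonempty X with hX | ⟨⟨x₀⟩⟩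
  · exact ⟨0, le_rfl, fun x => hX.elim x⟩
  have h1 : 0 ≤ C := (hd.inv.pos x₀).le.trans (hC.2 x₀).2
  have h2 : 0 ≤ C' := (hd.pos x₀).le.trans (hC'.2 x₀).2
  refine ⟨C' * C, mul_nonneg h2 h1, fun x y => ⟨div_nonneg (hd.pos x).le (hd.pos y).le, ?_⟩⟩
  rw [div_eq_mul_inv]
  exact mul_le_mul (hC'.2 x).2 (hC.2 y).2 (hd.inv.pos y).le h2

theorem symNorm_facts [μ.IsOpenPosMeasure] {r : ℝ} (hr : 0 < r) {d : X → ℝ} (hd : Regular d) :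
    Measurable (symNorm μ r d) ∧ (∀ x, 1 ≤ symNorm μ r d x) ∧
      ∃ C, ∀ x, symNorm μ r d x ≤ C := by
  have hv := regular_vol μ hr
  obtain ⟨C, hC0, hC⟩ := hd.ratio
  have hint : ∀ x, IntegrableOn (fun y => 1 + d x / d y) (Metric.ball x r) μ := by
    intro x
    refine Integrable.of_bound (C := 1 + C)
      (measurable_const.add (measurable_const.div hd.measurable)).aestronglyMeasurable
      (ae_of_all _ fun y => ?_)
    rw [Real.norm_eq_abs, abs_of_nonneg (by linarith [(hC x y).1])]
    linarith [(hC x y).2]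
  refine ⟨?_, fun x => ?_, 1 + C, fun x => ?_⟩
  · refine hv.measurable.inv.mul ?_
    have := (measurable_near hd.measurable r).stronglyMeasurable.integral_prod_right' (ν := μ)
    simpa only [integral_indicator Metric.isOpen_ball.measurableSet] using this.measurable
  · rw [symNorm, ← div_eq_inv_mul, le_div_iff₀ (hv.pos x), one_mul]
    calc vol μ r x = ∫ _ in Metric.ball x r, (1 : ℝ) ∂μ := by simp [vol]
      _ ≤ _ := integral_mono (integrable_const _) (hint x) fun y => by
          simp only; linarith [(hC x y).1]
  · rw [symNorm, ← div_eq_inv_mul, div_le_iff₀ (hv.pos x)]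
    calc _ ≤ ∫ _ in Metric.ball x r, (1 + C : ℝ) ∂μ :=
          integral_mono (hint x) (integrable_const _) fun y => by
            simp only; linarith [(hC x y).2]
      _ = _ := by simp [vol, mul_comm]

theorem symDensity_facts [μ.IsOpenPosMeasure] {r : ℝ} (hr : 0 < r) {d : X → ℝ} (hd : Regular d) :
    Measurable (Function.uncurry (symDensity μ r d)) ∧ (∀ x y, 0 ≤ symDensity μ r d x y) ∧
      (∃ C, ∀ x y, symDensity μ r d x y ≤ C) ∧ ∀ x, ∫ y, symDensity μ r d x y ∂μ = 1 := by
  have hv := regular_vol μ hr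
  obtain ⟨C, hC0, hC⟩ := hd.ratio
  obtain ⟨hn, hn1, -⟩ := symNorm_facts μ hr hd
  obtain ⟨_, Cv, _, hCv'⟩ := hv.inv.bounds
  have hCv : ∀ x, (vol μ r x)⁻¹ ≤ Cv := fun x => (hCv' x).2
  have hJ : ∀ x y, 0 ≤ (Metric.ball x r).indicator (fun y => 1 + d x / d y) y ∧
      (Metric.ball x r).indicator (fun y => 1 + d x / d y) y ≤ 1 + C := by
    intro x y
    have h1 := (hC x y).1
    have h2 := (hC x y).2
    by_cases hy : y ∈ Metric.ball x r
    · rw [indicator_of_mem hy]; constructor <;> linarith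
    · rw [indicator_of_notMem hy]; constructor <;> linarith
  have hni : ∀ x, 0 ≤ (symNorm μ r d x)⁻¹ ∧ (symNorm μ r d x)⁻¹ ≤ 1 := fun x =>
    ⟨inv_nonneg.2 (zero_le_one.trans (hn1 x)), inv_le_one_of_one_le₀ (hn1 x)⟩
  refine ⟨?_, fun x y => ?_, ⟨1 * Cv * (1 + C), fun x y => ?_⟩, fun x => ?_⟩
  · exact (((hn.comp measurable_fst).inv).mul ((hv.measurable.comp measurable_fst).inv)).mul
      (measurable_near hd.measurable r)
  · exact mul_nonneg (mul_nonneg (hni x).1 (hv.inv.pos x).le) (hJ x y).1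
  · have h0 : 0 ≤ Cv := (hv.inv.pos x).le.trans (hCv x)
    exact mul_le_mul (mul_le_mul (hni x).2 (hCv x) (hv.inv.pos x).le zero_le_one) (hJ x y).2
      (hJ x y).1 (by simpa using h0)
  · have h1 : symNorm μ r d x ≠ 0 := (zero_lt_one.trans_le (hn1 x)).ne'
    simp only [symDensity]
    rw [integral_const_mul, integral_indicator Metric.isOpen_ball.measurableSet, mul_assoc]
    exact inv_mul_cancel₀ h1

theorem lintegral_symDensity [μ.IsOpenPosMeasure] {r : ℝ} (hr : 0 < r) {d : X → ℝ}
    (hd : Regular d) (x : X) : ∫⁻ y, ENNReal.ofReal (symDensity μ r d x y) ∂μ = 1 := by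
  obtain ⟨hm, h0, ⟨C, hC⟩, h1⟩ := symDensity_facts μ hr hd
  rw [← ofReal_integral_eq_lintegral_ofReal _ (ae_of_all _ (h0 x)), h1, ENNReal.ofReal_one]
  refine Integrable.of_bound (C := C) (hm.comp measurable_prodMk_left).aestronglyMeasurable
    (ae_of_all _ fun y => ?_)
  rw [Real.norm_eq_abs, abs_of_nonneg (h0 x y)]
  exact hC x y

theorem isMarkovKernel_jump [μ.IsOpenPosMeasure] {r : ℝ} (hr : 0 < r) {d : X → ℝ}
    (hd : Regular d) : IsMarkovKernel (jumpKernel μ r d) := by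
  refine ⟨fun x => ⟨?_⟩⟩
  have hm := (symDensity_facts μ hr hd).1.ennreal_ofReal
  rw [jumpKernel, Kernel.withDensity_apply _ hm, withDensity_apply _ MeasurableSet.univ,
    Measure.restrict_univ, Kernel.const_apply]
  exact lintegral_symDensity μ hr hd x

theorem isMarkovKernel_holdJump [μ.IsOpenPosMeasure] {r : ℝ} (hr : 0 < r) {d τ : X → ℝ}
    (hd : Regular d) (hτ : Regular τ) : IsMarkovKernel (holdJumpKernel μ r d τ) := by
  refine ⟨fun x => ⟨?_⟩⟩
  have hm := (symDensity_facts μ hr hd).1.ennreal_ofReal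
  have he : Measurable (fun p : ℝ × ℝ => exponentialPDF p.1 p.2) := by
    simp only [exponentialPDF_eq]
    refine Measurable.ennreal_ofReal (Measurable.ite ?_ ?_ measurable_const)
    · exact measurableSet_le measurable_const measurable_snd
    · fun_prop
  have hm' : Measurable (Function.uncurry fun (s : ℝ × X) (z : ℝ × X) =>
      exponentialPDF (τ s.2)⁻¹ z.1 * ENNReal.ofReal (symDensity μ r d s.2 z.2)) := by
    have hτm := hτ.measurable
    have hF : Measurable fun q : (ℝ × X) × (ℝ × X) => ((τ q.1.2)⁻¹, q.2.1) := by fun_prop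
    have hG : Measurable fun q : (ℝ × X) × (ℝ × X) => (q.1.2, q.2.2) := by fun_prop
    have h1 := he.comp hF
    have h2 := hm.comp hG
    exact h1.mul h2
  rw [holdJumpKernel, Kernel.withDensity_apply _ hm', withDensity_apply _ MeasurableSet.univ,
    Measure.restrict_univ, Kernel.const_apply,
    lintegral_prod_mul (f := fun t => exponentialPDF (τ x.2)⁻¹ t)
      (g := fun y => ENNReal.ofReal (symDensity μ r d x.2 y))
      (he.comp measurable_prodMk_left).aemeasurable (hm.comp measurable_prodMk_left).aemeasurable,
    lintegral_exponentialPDF_eq_one (inv_pos.2 (hτ.pos _)), lintegral_symDensity μ hr hd, one_mul]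

/-! Measurability and boundedness of the local time exponent. -/

theorem setExponent_mono {A B : Set X} (h : A ⊆ B) : setExponent μ A ≤ setExponent μ B := by
  have h1 : ∀ ω : ℕ → X, exitStep A ω ≤ exitStep B ω := fun ω =>
    iInf_mono fun k => iInf_mono' fun hk => ⟨fun hA => hk (h hA), le_rfl⟩
  have h2 : ∀ r, maxExitSteps μ r A ≤ maxExitSteps μ r B := fun r =>
    iSup₂_le fun y hy => (lintegral_mono h1).trans (le_iSup₂ (f := fun y (_ : y ∈ B) =>
      meanExitSteps μ r B y) y (h hy))
  refine iSup_mono fun γ => iSup_mono' fun hγ => ⟨top_le_iff.1 ?_, le_rfl⟩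
  rw [← hγ]
  exact limsup_le_limsup (Eventually.of_forall fun r => by
    exact mul_le_mul_left (h2 r) _)

theorem upperSemicontinuous_timeExponent : UpperSemicontinuous (timeExponent μ) := by
  intro x a ha
  simp only [timeExponent, iInf_lt_iff] at ha
  obtain ⟨R, hR, hlt⟩ := ha
  filter_upwards [Metric.ball_mem_nhds x (half_pos hR)] with y hy
  refine lt_of_le_of_lt ((iInf₂_le (R / 2) (half_pos hR)).trans (setExponent_mono μ ?_)) hlt
  refine Metric.closedBall_subset_closedBall' ?_
  rw [Metric.mem_ball] at hy
  linarith

theorem regular_waitingTime (hβ : ∀ x, timeExponent μ x < ∞) {r : ℝ} (hr : 0 < r) :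
    Regular (waitingTime μ r) := by
  have hm : Measurable (timeExponentReal μ) :=
    (upperSemicontinuous_timeExponent μ).measurable.ennreal_toReal
  refine ⟨measurable_const.pow hm, ?_⟩
  rcases isEmpty_or_nonempty X with hX | hX
  · exact ⟨1, 1, one_pos, fun x => hX.elim x⟩
  obtain ⟨z, -, hz⟩ := ((upperSemicontinuous_timeExponent μ).upperSemicontinuousOn
    univ).exists_isMaxOn univ_nonempty isCompact_univ
  have hM : ∀ x, timeExponentReal μ x ≤ timeExponentReal μ z := fun x =>
    ENNReal.toReal_mono (hβ z).ne (hz (mem_univ x))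
  have h0 : ∀ x, 0 ≤ timeExponentReal μ x := fun x => ENNReal.toReal_nonneg
  refine ⟨min 1 (r ^ timeExponentReal μ z), max 1 (r ^ timeExponentReal μ z),
    lt_min one_pos (Real.rpow_pos_of_pos hr _), fun x => ?_⟩
  rcases le_total r 1 with h | h
  · refine ⟨(min_le_right _ _).trans ?_, le_max_of_le_left ?_⟩
    · exact Real.rpow_le_rpow_of_exponent_ge hr h (hM x)
    · exact Real.rpow_le_one hr.le h (h0 x)
  · refine ⟨(min_le_left _ _).trans ?_, le_max_of_le_right ?_⟩
    · exact Real.one_le_rpow h (h0 x)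
    · exact Real.rpow_le_rpow_of_exponent_le h (hM x)

theorem regular_dWeight [μ.IsOpenPosMeasure] (hβ : ∀ x, timeExponent μ x < ∞) {r : ℝ}
    (hr : 0 < r) : Regular (dWeight μ r) :=
  (regular_vol μ hr).mul (regular_waitingTime μ hβ hr)

/-- Existence of the operator `f ↦ g f + ∫_B k(·, y) f(y) dμ(y)` on `L²(B, n μ)`. -/
theorem exists_operator {B : Set X} {n g : X → ℝ} {k : X → X → ℝ}
    (hn1 : ∀ x, 1 ≤ n x) {N : ℝ} (hN : ∀ x, n x ≤ N)
    (hg : Measurable g) {G : ℝ} (hG : ∀ x, |g x| ≤ G)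
    (hk : Measurable (Function.uncurry k)) {K : ℝ} (hK : ∀ x y, |k x y| ≤ K) (hK0 : 0 ≤ K) :
    ∃ T : Lp ℝ 2 ((μ.withDensity fun x => ENNReal.ofReal (n x)).restrict B) →L[ℝ]
        Lp ℝ 2 ((μ.withDensity fun x => ENNReal.ofReal (n x)).restrict B),
      ∀ f, T f =ᵐ[(μ.withDensity fun x => ENNReal.ofReal (n x)).restrict B]
        fun x => g x * f x + ∫ y in B, k x y * f y ∂μ := by
  have hfin : IsFiniteMeasure (μ.withDensity fun x => ENNReal.ofReal (n x)) :=
    isFiniteMeasure_withDensity (ne_of_lt (lt_of_le_of_lt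
      (lintegral_mono fun x => ENNReal.ofReal_le_ofReal (hN x))
      (by simpa using ENNReal.mul_lt_top ENNReal.ofReal_lt_top (measure_lt_top μ univ))))
  have hle0 : μ ≤ μ.withDensity fun x => ENNReal.ofReal (n x) := by
    conv_lhs => rw [← withDensity_one (μ := μ)]
    refine withDensity_mono (ae_of_all _ fun x => ?_)
    simpa using ENNReal.ofReal_le_ofReal (hn1 x)
  have hle : μ.restrict B ≤ (μ.withDensity fun x => ENNReal.ofReal (n x)).restrict B :=
    Measure.restrict_mono le_rfl hle0
  set m := (μ.withDensity fun x => ENNReal.ofReal (n x)).restrict B with hm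
  have hfm : IsFiniteMeasure m := by rw [hm]; infer_instance
  clear_value m
  -- facts on elements of `L²`
  have hint : ∀ f : Lp ℝ 2 m, Integrable f m := fun f => (Lp.memLp f).integrable one_le_two
  have hint' : ∀ f : Lp ℝ 2 m, Integrable f (μ.restrict B) := fun f =>
    (hint f).mono_measure hle
  have hkint : ∀ (f : Lp ℝ 2 m) x, Integrable (fun y => k x y * f y) (μ.restrict B) := fun f x =>
    (hint' f).bdd_mul (c := K) (hk.comp measurable_prodMk_left).aestronglyMeasurable
      (ae_of_all _ fun y => hK x y)
  have hKmeas : ∀ f : Lp ℝ 2 m, StronglyMeasurable fun x => ∫ y in B, k x y * f y ∂μ := fun f => by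
    refine StronglyMeasurable.integral_prod_right (f := fun x y => k x y * f y) ?_
    exact hk.stronglyMeasurable.mul ((Lp.stronglyMeasurable f).comp_measurable measurable_snd)
  have hnorm : ∀ f : Lp ℝ 2 m, ∫ y, |f y| ∂m ≤ (m univ).toReal ^ (1 / 2 : ℝ) * ‖f‖ := by
    intro f
    have h1 := eLpNorm_le_eLpNorm_mul_rpow_measure_univ (p := 1) (q := 2) (μ := m) one_le_two
      (Lp.aestronglyMeasurable f)
    have h2 : ∫ y, |f y| ∂m = (eLpNorm f 1 m).toReal := by
      rw [eLpNorm_one_eq_lintegral_enorm, ← integral_norm_eq_lintegral_enorm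
        (Lp.aestronglyMeasurable f)]
      rfl
    rw [h2, Lp.norm_def, ENNReal.toReal_rpow, mul_comm, ← ENNReal.toReal_mul]
    refine ENNReal.toReal_mono (ENNReal.mul_ne_top (Lp.eLpNorm_ne_top f)
      (ENNReal.rpow_ne_top_of_nonneg (by norm_num) (measure_ne_top _ _))) ?_
    convert h1 using 3
    norm_num
  have hKbd : ∀ (f : Lp ℝ 2 m) x, ‖∫ y in B, k x y * f y ∂μ‖ ≤
      K * ((m univ).toReal ^ (1 / 2 : ℝ) * ‖f‖) := by
    intro f x
    calc ‖∫ y in B, k x y * f y ∂μ‖ ≤ ∫ y in B, K * |f y| ∂μ := by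
          refine norm_integral_le_of_norm_le ((hint' f).abs.const_mul K) (ae_of_all _ fun y => ?_)
          rw [norm_mul]
          exact mul_le_mul_of_nonneg_right (hK x y) (norm_nonneg _)
      _ = K * ∫ y in B, |f y| ∂μ := integral_const_mul _ _
      _ ≤ K * ∫ y, |f y| ∂m := by
          exact mul_le_mul_of_nonneg_left (integral_mono_measure hle
            (ae_of_all m fun y => abs_nonneg (f y)) (hint f).abs) hK0
      _ ≤ _ := by gcongr; exact hnorm f
  have hae : ∀ {u v : X → ℝ}, u =ᵐ[m] v → u =ᵐ[μ.restrict B] v := fun h =>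
    (Measure.absolutelyContinuous_of_le hle).ae_le h
  have hKmem : ∀ f : Lp ℝ 2 m, MemLp (fun x => ∫ y in B, k x y * f y ∂μ) 2 m := fun f =>
    MemLp.of_bound (hKmeas f).aestronglyMeasurable _ (ae_of_all _ (hKbd f))
  have hGmem : ∀ f : Lp ℝ 2 m, MemLp (fun x => g x * f x) 2 m := fun f =>
    (Lp.memLp f).of_le_mul (c := G) (hg.aestronglyMeasurable.mul (Lp.aestronglyMeasurable f))
      (ae_of_all _ fun x => by
        rw [norm_mul]
        exact mul_le_mul_of_nonneg_right (hG x) (norm_nonneg _))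
  let KL : Lp ℝ 2 m →ₗ[ℝ] Lp ℝ 2 m :=
    { toFun := fun f => (hKmem f).toLp _
      map_add' := fun f f' => by
        rw [← MemLp.toLp_add]
        refine MemLp.toLp_congr _ _ (ae_of_all _ fun x => ?_)
        simp only [Pi.add_apply]
        rw [← integral_add (hkint f x) (hkint f' x)]
        refine integral_congr_ae ?_
        filter_upwards [hae (Lp.coeFn_add f f')] with y hy
        rw [hy, Pi.add_apply, mul_add]
      map_smul' := fun a f => by
        rw [RingHom.id_apply, ← MemLp.toLp_const_smul]
        refine MemLp.toLp_congr _ _ (ae_of_all _ fun x => ?_)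
        simp only [Pi.smul_apply, smul_eq_mul]
        rw [← integral_const_mul]
        refine integral_congr_ae ?_
        filter_upwards [hae (Lp.coeFn_smul a f)] with y hy
        rw [hy, Pi.smul_apply, smul_eq_mul]
        ring }
  let ML : Lp ℝ 2 m →ₗ[ℝ] Lp ℝ 2 m :=
    { toFun := fun f => (hGmem f).toLp _
      map_add' := fun f f' => by
        rw [← MemLp.toLp_add]
        refine MemLp.toLp_congr _ _ ?_
        filter_upwards [Lp.coeFn_add f f'] with x hx
        rw [hx, Pi.add_apply, Pi.add_apply, mul_add]
      map_smul' := fun a f => by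
        rw [RingHom.id_apply, ← MemLp.toLp_const_smul]
        refine MemLp.toLp_congr _ _ ?_
        filter_upwards [Lp.coeFn_smul a f] with x hx
        rw [hx, Pi.smul_apply, Pi.smul_apply, smul_eq_mul, smul_eq_mul]
        ring }
  have hKL : ∀ f, ‖KL f‖ ≤ (m univ).toReal ^ (1 / 2 : ℝ) *
      (K * (m univ).toReal ^ (1 / 2 : ℝ)) * ‖f‖ := by
    intro f
    have hc : (0 : ℝ) ≤ K * ((m univ).toReal ^ (1 / 2 : ℝ) * ‖f‖) := by positivity
    have h1 := Lp.norm_le_of_ae_bound (f := KL f) hc (by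
      filter_upwards [(hKmem f).coeFn_toLp] with x hx
      change ‖((hKmem f).toLp _ : X → ℝ) x‖ ≤ _
      rw [hx]
      exact hKbd f x)
    refine h1.trans (le_of_eq ?_)
    simp only [measureUnivNNReal]
    norm_num
    have : ((m univ).toNNReal : ℝ) = (m univ).toReal := rfl
    rw [this]
    ring
  have hML : ∀ f, ‖ML f‖ ≤ G * ‖f‖ := by
    intro f
    refine Lp.norm_le_mul_norm_of_ae_le_mul ?_
    filter_upwards [(hGmem f).coeFn_toLp] with x hx
    change ‖((hGmem f).toLp _ : X → ℝ) x‖ ≤ _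
    rw [hx, norm_mul]
    exact mul_le_mul_of_nonneg_right (hG x) (norm_nonneg _)
  refine ⟨ML.mkContinuous _ hML + KL.mkContinuous _ hKL, fun f => ?_⟩
  filter_upwards [Lp.coeFn_add (ML f) (KL f), (hGmem f).coeFn_toLp, (hKmem f).coeFn_toLp]
    with x h1 h2 h3
  change ((ML f + KL f : Lp ℝ 2 m) : X → ℝ) x = _
  rw [h1, Pi.add_apply]
  change ((hGmem f).toLp _ : X → ℝ) x + ((hKmem f).toLp _ : X → ℝ) x = _
  rw [h2, h3]

theorem killedWalk_ae [μ.IsOpenPosMeasure] {r : ℝ} (hr : 0 < r) (B : Set X)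
    (f : Lp ℝ 2 ((nuMeasure μ r).restrict B)) :
    killedWalk μ r B f =ᵐ[(nuMeasure μ r).restrict B]
      fun x => ∫ y in B, wDensity μ r x y * f y ∂μ := by
  have hd := regular_vol μ hr
  obtain ⟨-, hn1, N, hN⟩ := symNorm_facts μ hr hd
  obtain ⟨hm, h0, ⟨C, hC⟩, -⟩ := symDensity_facts μ hr hd
  have h : ∃ T : Lp ℝ 2 ((nuMeasure μ r).restrict B) →L[ℝ] Lp ℝ 2 ((nuMeasure μ r).restrict B),
      ∀ f, T f =ᵐ[(nuMeasure μ r).restrict B]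
        fun x => ∫ y in B, wDensity μ r x y * f y ∂μ := by
    obtain ⟨T, hT⟩ := exists_operator μ (B := B) hn1 hN (g := fun _ => 0) measurable_const
      (G := 0) (by simp) hm (K := max C 0) (fun x y => by
        rw [abs_of_nonneg (h0 x y)]
        exact le_max_of_le_left (hC x y)) (le_max_right _ _)
    exact ⟨T, fun f => (hT f).trans (ae_of_all _ fun x => by
      simp only [zero_mul, zero_add]
      rfl)⟩
  rw [killedWalk, l2Operator, dif_pos h]
  exact h.choose_spec f

theorem killedGenerator_ae [μ.IsOpenPosMeasure] (hβ : ∀ x, timeExponent μ x < ∞) {r : ℝ}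
    (hr : 0 < r) (B : Set X) (f : Lp ℝ 2 ((muMeasure μ r).restrict B)) :
    killedGenerator μ r B f =ᵐ[(muMeasure μ r).restrict B]
      fun x => (waitingTime μ r x)⁻¹ * (f x - ∫ y in B, pDensity μ r x y * f y ∂μ) := by
  have hd := regular_dWeight μ hβ hr
  have hτ := (regular_waitingTime μ hβ hr).inv
  obtain ⟨-, hn1, N, hN⟩ := symNorm_facts μ hr hd
  obtain ⟨hm, h0, ⟨C, hC⟩, -⟩ := symDensity_facts μ hr hd
  obtain ⟨_, G, _, hG⟩ := hτ.bounds
  have h : ∃ T : Lp ℝ 2 ((muMeasure μ r).restrict B) →L[ℝ] Lp ℝ 2 ((muMeasure μ r).restrict B),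
      ∀ f, T f =ᵐ[(muMeasure μ r).restrict B] fun x =>
        (waitingTime μ r x)⁻¹ * (f x - ∫ y in B, pDensity μ r x y * f y ∂μ) := by
    obtain ⟨T, hT⟩ := exists_operator μ (B := B) hn1 hN
      (g := fun x => (waitingTime μ r x)⁻¹) hτ.measurable (G := G)
      (fun x => by rw [abs_of_pos (hτ.pos x)]; exact (hG x).2)
      (k := fun x y => -(waitingTime μ r x)⁻¹ * symDensity μ r (dWeight μ r) x y)
      ((hτ.measurable.comp measurable_fst).neg.mul hm) (K := |G| * |C|)
      (fun x y => by
        rw [abs_mul, abs_neg, abs_of_pos (hτ.pos x), abs_of_nonneg (h0 x y)]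
        exact mul_le_mul ((hG x).2.trans (le_abs_self _)) ((hC x y).trans (le_abs_self _))
          (h0 x y) (abs_nonneg _))
      (by positivity)
    refine ⟨T, fun f => (hT f).trans (ae_of_all _ fun x => ?_)⟩
    simp only [mul_assoc]
    rw [integral_const_mul, mul_sub, sub_eq_add_neg, neg_mul]
    rfl
  rw [killedGenerator, l2Operator, dif_pos h]
  exact h.choose_spec f

end Facts

end LocalWalk

namespace LocalWalk

section KilledChain

variable {S : Type*} [MeasurableSpace S]

/-- The paths that stay in `B` up to step `n`. -/
def stayIn (B : Set S) (n : ℕ) : Set (ℕ → S) := {ω | ∀ i ≤ n, ω i ∈ B}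

theorem measurableSet_stayIn {B : Set S} (hB : MeasurableSet B) (n : ℕ) :
    MeasurableSet (stayIn B n) := by
  have : stayIn B n = ⋂ i ≤ n, (fun ω : ℕ → S => ω i) ⁻¹' B := by
    ext ω
    simp [stayIn]
  rw [this]
  exact MeasurableSet.iInter fun i => MeasurableSet.iInter fun _ => measurable_pi_apply i hB

variable (κ : Kernel S S)

/-- The action on functions of the kernel `κ` killed outside `B`. -/
noncomputable def killedOp (B : Set S) (g : S → ℝ≥0∞) (x : S) : ℝ≥0∞ := ∫⁻ y in B, g y ∂κ x

/-- The Green function of the kernel `κ` killed outside `B`, applied to `g`. -/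
noncomputable def green (B : Set S) (g : S → ℝ≥0∞) (x : S) : ℝ≥0∞ :=
  ∑' k, (killedOp κ B)^[k] g x

theorem measurable_killedOp {B : Set S} (hB : MeasurableSet B) {g : S → ℝ≥0∞}
    (hg : Measurable g) : Measurable (killedOp κ B g) := by
  have : killedOp κ B g = fun x => ∫⁻ y, B.indicator g y ∂κ x := by
    funext x
    rw [killedOp, lintegral_indicator hB]
  rw [this]
  exact (hg.indicator hB).lintegral_kernel

theorem measurable_killedOp_iterate {B : Set S} (hB : MeasurableSet B) {g : S → ℝ≥0∞}
    (hg : Measurable g) (k : ℕ) : Measurable ((killedOp κ B)^[k] g) := by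
  induction k generalizing g with
  | zero => exact hg
  | succ k ih => exact ih (measurable_killedOp κ hB hg)

theorem measurable_green {B : Set S} (hB : MeasurableSet B) {g : S → ℝ≥0∞}
    (hg : Measurable g) : Measurable (green κ B g) :=
  Measurable.tsum fun k => measurable_killedOp_iterate κ hB hg k

theorem green_eq {B : Set S} (hB : MeasurableSet B) {g : S → ℝ≥0∞} (hg : Measurable g) (x : S) :
    green κ B g x = g x + killedOp κ B (green κ B g) x := by
  have h : killedOp κ B (green κ B g) x = ∑' k, (killedOp κ B)^[k + 1] g x := by
    simp only [Function.iterate_succ_apply']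
    simp only [killedOp, green]
    exact lintegral_tsum fun k => (measurable_killedOp_iterate κ hB hg k).aemeasurable
  rw [h]
  exact tsum_eq_zero_add' ENNReal.summable

variable [IsMarkovKernel κ]

theorem pathLaw_map_frestrictLe_zero (s : S) :
    (pathLaw κ s).map (Preorder.frestrictLe (π := fun _ => S) 0) = Measure.dirac (fun _ => s) := by
  rw [pathLaw, Kernel.traj_map_frestrictLe_apply, Kernel.partialTraj_self, Kernel.id_apply]

theorem lintegral_pathLaw_zero {h : S → ℝ≥0∞} (hh : Measurable h) (s : S) :
    ∫⁻ ω, h (ω 0) ∂pathLaw κ s = h s := by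
  have h1 := lintegral_map (μ := pathLaw κ s)
    (f := fun x : (i : Finset.Iic 0) → S => h (x ⟨0, Finset.mem_Iic.2 le_rfl⟩))
    (hh.comp (measurable_pi_apply _)) (Preorder.measurable_frestrictLe (X := fun _ => S) 0)
  rw [pathLaw_map_frestrictLe_zero, lintegral_dirac'
    (f := fun x : (i : Finset.Iic 0) → S => h (x ⟨0, Finset.mem_Iic.2 le_rfl⟩)) _ (hh.comp (measurable_pi_apply _))] at h1
  exact h1.symm

theorem lintegral_pathLaw_succ (s : S) (n : ℕ) {F : ((i : Finset.Iic n) → S) → ℝ≥0∞}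
    (hF : Measurable F) {h : S → ℝ≥0∞} (hh : Measurable h) :
    ∫⁻ ω, F (Preorder.frestrictLe (π := fun _ => S) n ω) * h (ω (n + 1)) ∂pathLaw κ s =
      ∫⁻ ω, F (Preorder.frestrictLe (π := fun _ => S) n ω) * ∫⁻ y, h y ∂κ (ω n)
        ∂pathLaw κ s := by
  have hFh : Measurable fun p : ((i : Finset.Iic n) → S) × S => F p.1 * h p.2 :=
    (hF.comp measurable_fst).mul (hh.comp measurable_snd)
  have hκ : Measurable fun x : (i : Finset.Iic n) → S =>
      F x * ∫⁻ y, h y ∂κ (x ⟨n, Finset.mem_Iic.2 le_rfl⟩) :=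
    hF.mul (hh.lintegral_kernel.comp (measurable_pi_apply _))
  have h1 := Kernel.partialTraj_compProd_eq_map_traj (X := fun _ => S)
    (κ := fun n => κ.comap (fun h : (i : Finset.Iic n) → S => h ⟨n, Finset.mem_Iic.2 le_rfl⟩)
      (measurable_pi_apply _)) (Nat.zero_le n) (x₀ := fun _ => s)
  have hm : Measurable fun ω : ℕ → S =>
      (Preorder.frestrictLe (π := fun _ => S) n ω, ω (n + 1)) :=
    (Preorder.measurable_frestrictLe (X := fun _ => S) n).prodMk (measurable_pi_apply _)
  have h2 := lintegral_map (μ := pathLaw κ s) hFh hm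
  rw [← h2, pathLaw, ← h1, Measure.lintegral_compProd hFh]
  rw [← Kernel.traj_map_frestrictLe_apply,
    lintegral_map _ (Preorder.measurable_frestrictLe (X := fun _ => S) n)]
  · refine lintegral_congr fun ω => ?_
    exact lintegral_const_mul (μ := κ (ω n)) (F (Preorder.frestrictLe (π := fun _ => S) n ω)) hh
  · convert hκ using 2 with x
    exact lintegral_const_mul (μ := κ (x ⟨n, Finset.mem_Iic.2 le_rfl⟩)) (F x) hh

theorem lintegral_stayIn_succ {B : Set S} (hB : MeasurableSet B) {h : S → ℝ≥0∞}
    (hh : Measurable h) (s : S) (n : ℕ) :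
    ∫⁻ ω, (stayIn B n).indicator 1 ω * h (ω (n + 1)) ∂pathLaw κ s =
      ∫⁻ ω, (stayIn B n).indicator 1 ω * ∫⁻ y, h y ∂κ (ω n) ∂pathLaw κ s := by
  let A : Set ((i : Finset.Iic n) → S) := {x | ∀ i, x i ∈ B}
  have hA : MeasurableSet A := by
    have : A = ⋂ i, (fun x : (i : Finset.Iic n) → S => x i) ⁻¹' B := by
      ext x
      simp [A]
    rw [this]
    exact MeasurableSet.iInter fun i => measurable_pi_apply i hB
  have h1 : ∀ ω : ℕ → S, (stayIn B n).indicator (1 : (ℕ → S) → ℝ≥0∞) ω =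
      A.indicator 1 (Preorder.frestrictLe (π := fun _ => S) n ω) := by
    intro ω
    have hiff : ω ∈ stayIn B n ↔ Preorder.frestrictLe (π := fun _ => S) n ω ∈ A := by
      simp [stayIn, A]
    by_cases h : ω ∈ stayIn B n
    · rw [indicator_of_mem h, indicator_of_mem (hiff.1 h), Pi.one_apply, Pi.one_apply]
    · rw [indicator_of_notMem h, indicator_of_notMem fun h' => h (hiff.2 h')]
  simp only [h1]
  exact lintegral_pathLaw_succ κ s n (measurable_one.indicator hA) hh

theorem lintegral_stayIn {B : Set S} (hB : MeasurableSet B) {g : S → ℝ≥0∞}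
    (hg : Measurable g) {s : S} (hs : s ∈ B) (k : ℕ) :
    ∫⁻ ω, (stayIn B k).indicator 1 ω * g (ω k) ∂pathLaw κ s = (killedOp κ B)^[k] g s := by
  induction k generalizing g with
  | zero =>
    have h1 : ∀ ω : ℕ → S, (stayIn B 0).indicator 1 ω * g (ω 0) = B.indicator g (ω 0) := by
      intro ω
      have : ω ∈ stayIn B 0 ↔ ω 0 ∈ B := by simp [stayIn]
      by_cases h : ω 0 ∈ B
      · rw [indicator_of_mem (this.2 h), indicator_of_mem h, Pi.one_apply, one_mul]
      · rw [indicator_of_notMem (fun h' => h (this.1 h')), indicator_of_notMem h, zero_mul]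
    simp only [h1]
    rw [lintegral_pathLaw_zero κ (hg.indicator hB), indicator_of_mem hs]
    rfl
  | succ k ih =>
    have h1 : ∀ ω : ℕ → S, (stayIn B (k + 1)).indicator 1 ω * g (ω (k + 1)) =
        (stayIn B k).indicator 1 ω * B.indicator g (ω (k + 1)) := by
      intro ω
      have hiff : ω ∈ stayIn B (k + 1) ↔ ω ∈ stayIn B k ∧ ω (k + 1) ∈ B := by
        simp only [stayIn, mem_ofPred_eq]
        refine ⟨fun h => ⟨fun i hi => h i (by lia), h _ le_rfl⟩, fun h i hi => ?_⟩
        rcases Nat.le_succ_iff.1 hi with hi | rfl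
        · exact h.1 i hi
        · exact h.2
      by_cases hk : ω ∈ stayIn B k <;> by_cases hb : ω (k + 1) ∈ B <;>
        simp [indicator, hiff, hk, hb]
    simp only [h1]
    rw [lintegral_stayIn_succ κ hB (hg.indicator hB)]
    simp only [lintegral_indicator hB]
    exact ih (measurable_killedOp κ hB hg)

/-- The Green function is a lower bound of the mean of every functional that dominates the
rewards collected before the exit from `B`. -/
theorem green_le_lintegral {B : Set S} (hB : MeasurableSet B) {h : S → ℝ≥0∞}
    (hh : Measurable h) {s : S} (hs : s ∈ B) {T : (ℕ → S) → ℝ≥0∞}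
    (hT : ∀ᵐ ω ∂pathLaw κ s, ∑' k, (stayIn B k).indicator 1 ω * h (ω (k + 1)) ≤ T ω) :
    green κ B (fun x => ∫⁻ y, h y ∂κ x) s ≤ ∫⁻ ω, T ω ∂pathLaw κ s := by
  refine le_trans (le_of_eq ?_) (lintegral_mono_ae hT)
  have hm : ∀ k, Measurable fun ω : ℕ → S => (stayIn B k).indicator 1 ω * h (ω (k + 1)) :=
    fun k => (measurable_one.indicator (measurableSet_stayIn hB k)).mul
      (hh.comp (measurable_pi_apply _))
  rw [lintegral_tsum fun k => (hm k).aemeasurable]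
  refine tsum_congr fun k => ?_
  rw [lintegral_stayIn_succ κ hB hh, ← lintegral_stayIn κ hB hh.lintegral_kernel hs]

theorem ae_pathLaw_succ {N : Set S} (hN : MeasurableSet N) (h : ∀ x, κ x N = 0) (s : S) :
    ∀ᵐ ω ∂pathLaw κ s, ∀ k, ω (k + 1) ∉ N := by
  rw [ae_all_iff]
  intro k
  have h1 := lintegral_pathLaw_succ κ s k (F := fun _ => 1) measurable_const
    (h := N.indicator 1) (measurable_one.indicator hN)
  simp only [lintegral_indicator_one hN, h, one_mul, lintegral_zero] at h1
  rw [lintegral_eq_zero_iff (show Measurable fun ω : ℕ → S => N.indicator 1 (ω (k + 1)) from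
    (measurable_one.indicator hN).comp (measurable_pi_apply _))] at h1
  filter_upwards [h1] with ω hω hmem
  simp [hmem] at hω

theorem ae_pathLaw_zero {N : Set S} (hN : MeasurableSet N) {s : S} (hs : s ∉ N) :
    ∀ᵐ ω ∂pathLaw κ s, ω 0 ∉ N := by
  have h1 := lintegral_pathLaw_zero κ (measurable_one.indicator hN) s
  rw [indicator_of_notMem hs,
    lintegral_eq_zero_iff (show Measurable fun ω : ℕ → S => N.indicator 1 (ω 0) from
      (measurable_one.indicator hN).comp (measurable_pi_apply _))] at h1
  filter_upwards [h1] with ω hω hmem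
  simp [hmem] at hω

end KilledChain

section ExitTimes

variable {S : Type*}

theorem tsum_stayIn_le {B : Set S} {ω : ℕ → S} {n : ℕ} (hn : ω n ∉ B) (f : ℕ → ℝ≥0∞) :
    ∑' k, (stayIn B k).indicator 1 ω * f k ≤ ∑ k ∈ Finset.range n, f k := by
  rw [tsum_eq_sum (s := Finset.range n)]
  · refine Finset.sum_le_sum fun k _ => ?_
    by_cases h : ω ∈ stayIn B k <;> simp [h]
  · intro k hk
    have : ω ∉ stayIn B k := fun h => hn (h n (by simpa using hk))
    simp [this]

theorem tsum_stayIn_le_exitStep (B : Set S) (ω : ℕ → S) :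
    ∑' k, (stayIn B k).indicator 1 ω * 1 ≤ exitStep B ω :=
  le_iInf₂ fun n hn => (tsum_stayIn_le hn _).trans (by simp)

theorem tsum_stayIn_le_exitTime {B : Set S} {ω : ℕ → ℝ × S} (h0 : (ω 0).2 ∈ B)
    (hpos : ∀ k, 0 ≤ (ω (k + 1)).1) :
    ∑' k, (stayIn (Prod.snd ⁻¹' B) k).indicator 1 ω * ENNReal.ofReal (ω (k + 1)).1 ≤
      exitTime B ω := by
  refine le_iInf₂ fun t ht => ?_
  rw [position] at ht
  set A : Set ℕ := {k : ℕ | ∑ j ∈ Finset.Icc 1 k, (ω j).1 ≤ (t : ℝ)} with hA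
  have hne : A.Nonempty := ⟨0, by simp [hA]⟩
  have hbdd : BddAbove A := by
    by_contra hb
    rw [Nat.sSup_of_not_bddAbove hb] at ht
    exact ht h0
  have hmem : ∑ j ∈ Finset.Icc 1 (sSup A), (ω j).1 ≤ (t : ℝ) := Nat.sSup_mem hne hbdd
  refine (tsum_stayIn_le (B := Prod.snd ⁻¹' B) ht fun k => ENNReal.ofReal (ω (k + 1)).1).trans ?_
  rw [← ENNReal.ofReal_sum_of_nonneg fun k _ => hpos k]
  refine ENNReal.ofReal_le_of_le_toReal (le_trans (le_of_eq ?_) hmem)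
  rw [Finset.range_eq_Ico, Finset.sum_Ico_add' (fun j => (ω j).1)]
  refine Finset.sum_congr ?_ fun _ _ => rfl
  ext j
  simp only [Finset.mem_Ico, Finset.mem_Icc]
  lia

end ExitTimes

section Spectrum

variable {H : Type*} [NormedAddCommGroup H] [InnerProductSpace ℝ H]

open scoped RealInnerProductSpace

theorem isUnit_of_coercive [CompleteSpace H] {S : H →L[ℝ] H} {c : ℝ} (hc : 0 < c)
    (h : ∀ f, c * ‖f‖ ^ 2 ≤ ⟪S f, f⟫) : IsUnit S := by
  let Bf : H →L[ℝ] H →L[ℝ] ℝ := (innerSL ℝ).comp S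
  have hco : IsCoercive Bf := ⟨c, hc, fun f => by
    have := h f
    rw [pow_two, ← mul_assoc] at this
    exact this⟩
  have hS : S = (hco.continuousLinearEquivOfBilin : H →L[ℝ] H) := by
    ext f
    refine hco.unique_continuousLinearEquivOfBilin fun w => ?_
    rfl
  rw [hS]
  exact ⟨ContinuousLinearEquiv.toUnit hco.continuousLinearEquivOfBilin, rfl⟩

theorem le_of_mem_spectrum [CompleteSpace H] {T : H →L[ℝ] H} {c : ℝ} (h : ∀ f, c * ‖f‖ ^ 2 ≤ ⟪T f, f⟫) {a : ℝ}
    (ha : a ∈ spectrum ℝ T) : c ≤ a := by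
  by_contra! hlt
  refine ha ?_
  rw [spectrum.mem_resolventSet_iff, ← IsUnit.neg_iff]
  refine isUnit_of_coercive (sub_pos.2 hlt) fun f => ?_
  have : (-(algebraMap ℝ (H →L[ℝ] H) a - T)) f = T f - a • f := by
    simp [Algebra.algebraMap_eq_smul_one]
  rw [this, inner_sub_left, real_inner_smul_left, real_inner_self_eq_norm_sq]
  linarith [h f]

/-- For a symmetric nonnegative form, `‖S f‖² ≤ ‖S‖ ⟪S f, f⟫`. -/
theorem norm_sq_le_of_nonneg {S : H →L[ℝ] H} (hs : ∀ f g, ⟪S f, g⟫ = ⟪f, S g⟫)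
    (h0 : ∀ f, 0 ≤ ⟪S f, f⟫) (f : H) : ‖S f‖ ^ 2 ≤ ‖S‖ * ⟪S f, f⟫ := by
  have key : ∀ t : ℝ, 0 ≤ ⟪S (S f), S f⟫ * (t * t) + 2 * ‖S f‖ ^ 2 * t + ⟪S f, f⟫ := by
    intro t
    have h1 := h0 (f + t • S f)
    simp only [map_add, map_smul, inner_add_left, inner_add_right, real_inner_smul_left,
      real_inner_smul_right] at h1
    rw [hs (S f) f, real_inner_self_eq_norm_sq] at h1
    linarith
  have hd := discrim_le_zero key
  rw [discrim] at hd
  have h2 : ⟪S (S f), S f⟫ ≤ ‖S‖ * ‖S f‖ ^ 2 := by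
    refine (real_inner_le_norm _ _).trans ?_
    rw [pow_two, ← mul_assoc]
    exact mul_le_mul_of_nonneg_right (S.le_opNorm _) (norm_nonneg _)
  rcases (norm_nonneg (S f)).eq_or_lt with hz | hz
  · rw [← hz]
    simpa using mul_nonneg (norm_nonneg S) (h0 f)
  · have h3 : (‖S f‖ ^ 2) * ‖S f‖ ^ 2 ≤ (‖S‖ * ⟪S f, f⟫) * ‖S f‖ ^ 2 := by
      nlinarith [mul_le_mul_of_nonneg_right h2 (h0 f)]
    exact le_of_mul_le_mul_right h3 (by positivity)

theorem spectrum_nonempty_of_symmetric [Nontrivial H] {T : H →L[ℝ] H}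
    (hs : ∀ f g, ⟪T f, g⟫ = ⟪f, T g⟫) : (spectrum ℝ T).Nonempty := by
  let N : Set ℝ := (fun f => ⟪T f, f⟫) '' Metric.sphere 0 1
  obtain ⟨u, hu⟩ := exists_norm_eq H zero_le_one
  have hN : N.Nonempty := ⟨_, u, by simpa using hu, rfl⟩
  have hb : BddBelow N := by
    refine ⟨-‖T‖, ?_⟩
    rintro _ ⟨f, hf, rfl⟩
    have h1 : ‖f‖ = 1 := by simpa using hf
    have h2 := abs_real_inner_le_norm (T f) f
    have h3 := T.le_opNorm f
    rw [h1, mul_one] at h2 h3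
    exact (abs_le.1 (h2.trans h3)).1
  set a := sInf N with ha
  have hform : ∀ f, a * ‖f‖ ^ 2 ≤ ⟪T f, f⟫ := by
    intro f
    rcases eq_or_ne f 0 with rfl | hf
    · simp
    · have hn : 0 < ‖f‖ := norm_pos_iff.2 hf
      have h1 : a ≤ ⟪T (‖f‖⁻¹ • f), ‖f‖⁻¹ • f⟫ :=
        csInf_le hb ⟨_, by simp [norm_smul, hn.ne'], rfl⟩
      rw [map_smul, real_inner_smul_left, real_inner_smul_right] at h1
      calc a * ‖f‖ ^ 2 ≤ (‖f‖⁻¹ * (‖f‖⁻¹ * ⟪T f, f⟫)) * ‖f‖ ^ 2 := by gcongr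
        _ = ⟪T f, f⟫ := by field_simp
  refine ⟨a, fun hunit => ?_⟩
  rw [spectrum.mem_resolventSet_iff, ← IsUnit.neg_iff] at hunit
  set S : H →L[ℝ] H := -(algebraMap ℝ (H →L[ℝ] H) a - T) with hS
  have hSf : ∀ f, S f = T f - a • f := fun f => by
    simp [hS, Algebra.algebraMap_eq_smul_one]
  have hSS : ∀ f g, ⟪S f, g⟫ = ⟪f, S g⟫ := fun f g => by
    rw [hSf, hSf, inner_sub_left, inner_sub_right, real_inner_smul_left, real_inner_smul_right, hs]
  have hform' : ∀ f, ⟪S f, f⟫ = ⟪T f, f⟫ - a * ‖f‖ ^ 2 := fun f => by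
    rw [hSf, inner_sub_left, real_inner_smul_left, real_inner_self_eq_norm_sq]
  have h0 : ∀ f, 0 ≤ ⟪S f, f⟫ := fun f => by
    rw [hform']
    linarith [hform f]
  obtain ⟨U, hU⟩ := hunit
  set V : H →L[ℝ] H := ↑U⁻¹ with hV
  have hVS : ∀ f, V (S f) = f := fun f => by
    have : V * S = 1 := by rw [hV, ← hU, Units.inv_mul]
    exact congrArg (fun W : H →L[ℝ] H => W f) this
  have hlow : ∀ f, ‖f‖ = 1 → 1 ≤ ‖V‖ ^ 2 * ‖S‖ * ⟪S f, f⟫ := fun f hf => by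
    have h1 := V.le_opNorm (S f)
    rw [hVS, hf] at h1
    calc (1 : ℝ) ≤ (‖V‖ * ‖S f‖) ^ 2 := one_le_pow₀ h1
      _ = ‖V‖ ^ 2 * ‖S f‖ ^ 2 := by ring
      _ ≤ ‖V‖ ^ 2 * (‖S‖ * ⟪S f, f⟫) := by
          gcongr
          exact norm_sq_le_of_nonneg hSS h0 f
      _ = _ := by ring
  set K := ‖V‖ ^ 2 * ‖S‖ with hK
  have hK0 : 0 ≤ K := by positivity
  obtain ⟨_, ⟨f, hf, rfl⟩, hlt⟩ := exists_lt_of_csInf_lt hN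
    (show sInf N < a + 1 / (K + 1) by rw [← ha]; linarith [show 0 < 1 / (K + 1) by positivity])
  have hf1 : ‖f‖ = 1 := by simpa using hf
  have h1 := hlow f hf1
  have h2 : ⟪S f, f⟫ < 1 / (K + 1) := by
    rw [hform', hf1]
    simp only at hlt
    linarith
  have h3 : K * ⟪S f, f⟫ ≤ K * (1 / (K + 1)) := by gcongr
  have h4 : K * (1 / (K + 1)) < 1 := by
    rw [mul_one_div, div_lt_one (by positivity)]
    linarith
  linarith

theorem le_sInf_spectrum [CompleteSpace H] [Nontrivial H] {T : H →L[ℝ] H} (hs : ∀ f g, ⟪T f, g⟫ = ⟪f, T g⟫)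
    {c : ℝ} (h : ∀ f, c * ‖f‖ ^ 2 ≤ ⟪T f, f⟫) : c ≤ sInf (spectrum ℝ T) :=
  le_csInf (spectrum_nonempty_of_symmetric hs) fun _ ha => le_of_mem_spectrum h ha

end Spectrum

section Form

open scoped RealInnerProductSpace

variable {X : Type*} [MetricSpace X]

/-- The symmetric jump intensity `(1 / d(x) + 1 / d(y)) χ_{B_r(x)}(y)`. -/
noncomputable def intensity (r : ℝ) (d : X → ℝ) (x y : X) : ℝ :=
  (Metric.ball x r).indicator (fun y => (d x)⁻¹ + (d y)⁻¹) y

theorem intensity_symm (r : ℝ) (d : X → ℝ) (x y : X) :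
    intensity r d x y = intensity r d y x := by
  by_cases h : y ∈ Metric.ball x r
  · rw [intensity, intensity, indicator_of_mem h, indicator_of_mem (Metric.mem_ball_comm.1 h),
      add_comm]
  · rw [intensity, intensity, indicator_of_notMem h,
      indicator_of_notMem fun h' => h (Metric.mem_ball_comm.1 h')]

variable [CompactSpace X] [MeasurableSpace X] [BorelSpace X]

theorem intensity_facts (r : ℝ) {d : X → ℝ} (hd : Regular d) :
    Measurable (Function.uncurry (intensity r d)) ∧ (∀ x y, 0 ≤ intensity r d x y) ∧
      ∃ K, ∀ x y, intensity r d x y ≤ K := by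
  refine ⟨?_, fun x y => indicator_nonneg (fun y _ => ?_) y, ?_⟩
  · have : Function.uncurry (intensity r d) = indicator {p : X × X | p.2 ∈ Metric.ball p.1 r}
        (fun p => (d p.1)⁻¹ + (d p.2)⁻¹) := rfl
    rw [this]
    exact (((hd.measurable.comp measurable_fst).inv).add
      ((hd.measurable.comp measurable_snd).inv)).indicator (measurableSet_near r)
  · exact add_nonneg (hd.inv.pos x).le (hd.inv.pos y).le
  · obtain ⟨c, C, -, h⟩ := hd.inv.bounds
    refine ⟨C + C, fun x y => indicator_le_self' (fun y _ => ?_) y |>.trans ?_⟩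
    · exact add_nonneg (hd.inv.pos x).le (hd.inv.pos y).le
    · exact add_le_add (h x).2 (h y).2

variable (μ : Measure X) [IsFiniteMeasure μ] [μ.IsOpenPosMeasure]

theorem symNorm_mul_symDensity {r : ℝ} (hr : 0 < r) {d τ : X → ℝ} (hd : Regular d)
    (hdτ : ∀ x, d x = vol μ r x * τ x) (x y : X) :
    symNorm μ r d x * (τ x)⁻¹ * symDensity μ r d x y = intensity r d x y := by
  have hn : symNorm μ r d x ≠ 0 := (zero_lt_one.trans_le ((symNorm_facts μ hr hd).2.1 x)).ne'
  rw [symDensity, intensity]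
  by_cases h : y ∈ Metric.ball x r
  · rw [indicator_of_mem h, indicator_of_mem h]
    have h1 : (d x)⁻¹ = (vol μ r x)⁻¹ * (τ x)⁻¹ := by rw [hdτ x, mul_inv]
    calc _ = (symNorm μ r d x * (symNorm μ r d x)⁻¹) * ((vol μ r x)⁻¹ * (τ x)⁻¹) *
          (1 + d x / d y) := by ring
      _ = (d x)⁻¹ * (1 + d x / d y) := by rw [mul_inv_cancel₀ hn, one_mul, h1]
      _ = _ := by
        have := (hd.pos x).ne'
        have := (hd.pos y).ne'
        field_simp
  · rw [indicator_of_notMem h, indicator_of_notMem h, mul_zero, mul_zero]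

/-- The measure `n μ` on `B`, with `n` the normalising factor of the walk. -/
noncomputable abbrev speedMeasure (r : ℝ) (d : X → ℝ) (B : Set X) : Measure X :=
  (μ.withDensity fun x => ENNReal.ofReal (symNorm μ r d x)).restrict B

variable {μ} {r : ℝ} {d τ : X → ℝ} {B : Set X}

theorem restrict_le_speedMeasure (hr : 0 < r) (hd : Regular d) :
    μ.restrict B ≤ speedMeasure μ r d B := by
  refine Measure.restrict_mono le_rfl ?_
  conv_lhs => rw [← withDensity_one (μ := μ)]
  refine withDensity_mono (ae_of_all _ fun x => ?_)
  simpa using ENNReal.ofReal_le_ofReal ((symNorm_facts μ hr hd).2.1 x)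

theorem isFiniteMeasure_speedMeasure (hr : 0 < r) (hd : Regular d) :
    IsFiniteMeasure (speedMeasure μ r d B) := by
  obtain ⟨-, -, N, hN⟩ := symNorm_facts μ hr hd
  have : IsFiniteMeasure (μ.withDensity fun x => ENNReal.ofReal (symNorm μ r d x)) :=
    isFiniteMeasure_withDensity (ne_of_lt (lt_of_le_of_lt
      (lintegral_mono fun x => ENNReal.ofReal_le_ofReal (hN x))
      (by simpa using ENNReal.mul_lt_top ENNReal.ofReal_lt_top (measure_lt_top μ univ))))
  infer_instance

theorem integral_speedMeasure (hr : 0 < r) (hd : Regular d) (hB : MeasurableSet B) (u : X → ℝ) :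
    ∫ x, u x ∂speedMeasure μ r d B = ∫ x in B, symNorm μ r d x * u x ∂μ := by
  obtain ⟨hm, h1, -⟩ := symNorm_facts μ hr hd
  rw [speedMeasure, restrict_withDensity hB, integral_withDensity_eq_integral_toReal_smul
    hm.ennreal_ofReal (ae_of_all _ fun x => ENNReal.ofReal_lt_top)]
  refine integral_congr_ae (ae_of_all _ fun x => ?_)
  simp only [smul_eq_mul]
  rw [ENNReal.toReal_ofReal (zero_le_one.trans (h1 x))]

theorem inner_speedMeasure (hr : 0 < r) (hd : Regular d) (hB : MeasurableSet B)
    (f g : Lp ℝ 2 (speedMeasure μ r d B)) :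
    ⟪f, g⟫ = ∫ x in B, symNorm μ r d x * (f x * g x) ∂μ := by
  rw [L2.inner_def, ← integral_speedMeasure hr hd hB]
  refine integral_congr_ae (ae_of_all _ fun x => ?_)
  simp [mul_comm]

theorem memLp_restrict (hr : 0 < r) (hd : Regular d) (f : Lp ℝ 2 (speedMeasure μ r d B)) :
    MemLp f 2 (μ.restrict B) :=
  (Lp.memLp f).mono_measure (restrict_le_speedMeasure hr hd)

theorem integrable_intensity_mul (r : ℝ) (hd : Regular d) {u : X × X → ℝ}
    {ρ : Measure (X × X)} (hu : Integrable u ρ) :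
    Integrable (fun z => intensity r d z.1 z.2 * u z) ρ := by
  obtain ⟨hm, h0, K, hK⟩ := intensity_facts r hd
  refine hu.bdd_mul (c := K) hm.aestronglyMeasurable (ae_of_all _ fun z => ?_)
  rw [Real.norm_eq_abs, abs_of_nonneg (h0 _ _)]
  exact hK _ _

/-- The form of the killed generator. -/
theorem inner_generator (hr : 0 < r) (hd : Regular d) (hτ : Regular τ)
    (hdτ : ∀ x, d x = vol μ r x * τ x) (hB : MeasurableSet B)
    {T : Lp ℝ 2 (speedMeasure μ r d B) →L[ℝ] Lp ℝ 2 (speedMeasure μ r d B)}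
    (hT : ∀ f, T f =ᵐ[speedMeasure μ r d B]
      fun x => (τ x)⁻¹ * (f x - ∫ y in B, symDensity μ r d x y * f y ∂μ))
    (f g : Lp ℝ 2 (speedMeasure μ r d B)) :
    ⟪T f, g⟫ = (∫ x in B, symNorm μ r d x * (τ x)⁻¹ * (f x * g x) ∂μ) -
      ∫ z, intensity r d z.1 z.2 * (g z.1 * f z.2) ∂(μ.restrict B).prod (μ.restrict B) := by
  have hle := (restrict_le_speedMeasure (μ := μ) (B := B) hr hd)
  obtain ⟨hnm, hn1, N, hN⟩ := symNorm_facts μ hr hd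
  obtain ⟨_, C, _, hC⟩ := hτ.inv.bounds
  have hf := memLp_restrict hr hd f
  have hg := memLp_restrict hr hd g
  have hfg : Integrable (fun x => f x * g x) (μ.restrict B) := hf.integrable_mul hg
  have hfi := hf.integrable one_le_two
  have hgi := hg.integrable one_le_two
  have hJ := integrable_intensity_mul r hd (hgi.mul_prod hfi)
  rw [inner_speedMeasure hr hd hB, integral_prod _ hJ, ← integral_sub]
  · refine integral_congr_ae ?_
    filter_upwards [(Measure.absolutelyContinuous_of_le hle).ae_le (hT f)] with x hx
    rw [hx]
    have h1 : ∫ y in B, intensity r d x y * (g x * f y) ∂μ =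
        symNorm μ r d x * (τ x)⁻¹ * g x * ∫ y in B, symDensity μ r d x y * f y ∂μ := by
      rw [← integral_const_mul]
      refine integral_congr_ae (ae_of_all _ fun y => ?_)
      simp only
      rw [← symNorm_mul_symDensity μ hr hd hdτ x y]
      ring
    rw [h1]
    ring
  · refine hfg.bdd_mul (c := N * C) (hnm.mul hτ.inv.measurable).aestronglyMeasurable
      (ae_of_all _ fun x => ?_)
    rw [Real.norm_eq_abs, abs_mul, abs_of_pos (hτ.inv.pos x),
      abs_of_nonneg (zero_le_one.trans (hn1 x))]
    exact mul_le_mul (hN x) (hC x).2 (hτ.inv.pos x).le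
      ((zero_le_one.trans (hn1 x)).trans (hN x))
  · exact hJ.integral_prod_left

theorem generator_symm (hr : 0 < r) (hd : Regular d) (hτ : Regular τ)
    (hdτ : ∀ x, d x = vol μ r x * τ x) (hB : MeasurableSet B)
    {T : Lp ℝ 2 (speedMeasure μ r d B) →L[ℝ] Lp ℝ 2 (speedMeasure μ r d B)}
    (hT : ∀ f, T f =ᵐ[speedMeasure μ r d B]
      fun x => (τ x)⁻¹ * (f x - ∫ y in B, symDensity μ r d x y * f y ∂μ))
    (f g : Lp ℝ 2 (speedMeasure μ r d B)) : ⟪T f, g⟫ = ⟪f, T g⟫ := by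
  rw [real_inner_comm (T g) f, inner_generator hr hd hτ hdτ hB hT,
    inner_generator hr hd hτ hdτ hB hT, ← integral_prod_swap]
  congr 1
  · simp only [mul_comm]
  · refine integral_congr_ae (ae_of_all _ fun z => ?_)
    simp only [Prod.fst_swap, Prod.snd_swap]
    rw [intensity_symm]
    ring

/-- A positive supersolution bounds the form from below (ground state transform). -/
theorem le_inner_of_supersolution (hr : 0 < r) (hd : Regular d) (hτ : Regular τ)
    (hdτ : ∀ x, d x = vol μ r x * τ x) (hB : MeasurableSet B)
    {T : Lp ℝ 2 (speedMeasure μ r d B) →L[ℝ] Lp ℝ 2 (speedMeasure μ r d B)}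
    (hT : ∀ f, T f =ᵐ[speedMeasure μ r d B]
      fun x => (τ x)⁻¹ * (f x - ∫ y in B, symDensity μ r d x y * f y ∂μ))
    {h : X → ℝ} (hh : Regular h) {c : ℝ}
    (hsuper : ∀ x ∈ B, c * τ x * h x + ∫ y in B, symDensity μ r d x y * h y ∂μ ≤ h x)
    (f : Lp ℝ 2 (speedMeasure μ r d B)) : c * ‖f‖ ^ 2 ≤ ⟪T f, f⟫ := by
  obtain ⟨hnm, hn1, N, hN⟩ := symNorm_facts μ hr hd
  obtain ⟨_, C, _, hC⟩ := hτ.inv.bounds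
  obtain ⟨_, H, _, hH⟩ := hh.bounds
  obtain ⟨_, H', _, hH'⟩ := hh.inv.bounds
  have hf := memLp_restrict hr hd f
  have hfi := hf.integrable one_le_two
  have hff : Integrable (fun x => f x * f x) (μ.restrict B) := hf.integrable_mul hf
  have hnff : Integrable (fun x => symNorm μ r d x * (f x * f x)) (μ.restrict B) := by
    refine hff.bdd_mul (c := N) hnm.aestronglyMeasurable (ae_of_all _ fun x => ?_)
    rw [Real.norm_eq_abs, abs_of_nonneg (zero_le_one.trans (hn1 x))]
    exact hN x
  have hnτff : Integrable (fun x => symNorm μ r d x * (τ x)⁻¹ * (f x * f x)) (μ.restrict B) := by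
    refine hff.bdd_mul (c := N * C) (hnm.mul hτ.inv.measurable).aestronglyMeasurable
      (ae_of_all _ fun x => ?_)
    rw [Real.norm_eq_abs, abs_mul, abs_of_pos (hτ.inv.pos x),
      abs_of_nonneg (zero_le_one.trans (hn1 x))]
    exact mul_le_mul (hN x) (hC x).2 (hτ.inv.pos x).le
      ((zero_le_one.trans (hn1 x)).trans (hN x))
  have hhi : Integrable h (μ.restrict B) :=
    Integrable.of_bound (C := H) hh.measurable.aestronglyMeasurable (ae_of_all _ fun x => by
      rw [Real.norm_eq_abs, abs_of_pos (hh.pos x)]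
      exact (hH x).2)
  have hffh : Integrable (fun x => (h x)⁻¹ * (f x * f x)) (μ.restrict B) := by
    refine hff.bdd_mul (c := H') hh.inv.measurable.aestronglyMeasurable (ae_of_all _ fun x => ?_)
    rw [Real.norm_eq_abs, abs_of_pos (hh.inv.pos x)]
    exact (hH' x).2
  have hJ := integrable_intensity_mul r hd (hfi.mul_prod hfi)
  have hJ1 := integrable_intensity_mul r hd (hffh.mul_prod hhi)
  have hJ2 := integrable_intensity_mul r hd (hhi.mul_prod hffh)
  set ρ := (μ.restrict B).prod (μ.restrict B) with hρ
  have hswap : ∫ z, intensity r d z.1 z.2 * (h z.1 * ((h z.2)⁻¹ * (f z.2 * f z.2))) ∂ρ =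
      ∫ z, intensity r d z.1 z.2 * ((h z.1)⁻¹ * (f z.1 * f z.1) * h z.2) ∂ρ := by
    rw [hρ, ← integral_prod_swap]
    refine integral_congr_ae (ae_of_all _ fun z => ?_)
    simp only [Prod.fst_swap, Prod.snd_swap]
    rw [intensity_symm]
    ring
  have hyoung : ∫ z, intensity r d z.1 z.2 * (f z.1 * f z.2) ∂ρ ≤
      ∫ z, intensity r d z.1 z.2 * ((h z.1)⁻¹ * (f z.1 * f z.1) * h z.2) ∂ρ := by
    have h1 : ∫ z, 2 * (intensity r d z.1 z.2 * (f z.1 * f z.2)) ∂ρ ≤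
        ∫ z, (intensity r d z.1 z.2 * ((h z.1)⁻¹ * (f z.1 * f z.1) * h z.2) +
          intensity r d z.1 z.2 * (h z.1 * ((h z.2)⁻¹ * (f z.2 * f z.2)))) ∂ρ := by
      refine integral_mono (hJ.const_mul 2) (hJ1.add hJ2) fun z => ?_
      simp only
      have hJ0 := (intensity_facts r hd).2.1 z.1 z.2
      have ha := hh.pos z.1
      have hb := hh.pos z.2
      have h2 : 2 * (f z.1 * f z.2) ≤
          (h z.1)⁻¹ * (f z.1 * f z.1) * h z.2 + h z.1 * ((h z.2)⁻¹ * (f z.2 * f z.2)) := by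
        have h3 : (h z.1)⁻¹ * (f z.1 * f z.1) * h z.2 + h z.1 * ((h z.2)⁻¹ * (f z.2 * f z.2)) -
            2 * (f z.1 * f z.2) =
            (f z.1 * h z.2 - f z.2 * h z.1) ^ 2 * ((h z.1)⁻¹ * (h z.2)⁻¹) := by
          field_simp
          ring
        have h4 : 0 ≤ (f z.1 * h z.2 - f z.2 * h z.1) ^ 2 * ((h z.1)⁻¹ * (h z.2)⁻¹) := by
          positivity
        linarith
      calc _ = intensity r d z.1 z.2 * (2 * (f z.1 * f z.2)) := by ring
        _ ≤ _ := mul_le_mul_of_nonneg_left h2 hJ0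
        _ = _ := by ring
    rw [integral_const_mul, integral_add hJ1 hJ2, hswap] at h1
    linarith
  have hground : ∫ z, intensity r d z.1 z.2 * ((h z.1)⁻¹ * (f z.1 * f z.1) * h z.2) ∂ρ ≤
      ∫ x in B, (symNorm μ r d x * (τ x)⁻¹ * (f x * f x) -
        c * (symNorm μ r d x * (f x * f x))) ∂μ := by
    rw [hρ, integral_prod _ hJ1]
    refine integral_mono_ae hJ1.integral_prod_left (hnτff.sub (hnff.const_mul c)) ?_
    filter_upwards [ae_restrict_mem hB] with x hx
    have h1 : ∫ y in B, intensity r d x y * ((h x)⁻¹ * (f x * f x) * h y) ∂μ =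
        symNorm μ r d x * (τ x)⁻¹ * (f x * f x) * (h x)⁻¹ *
          ∫ y in B, symDensity μ r d x y * h y ∂μ := by
      rw [← integral_const_mul]
      refine integral_congr_ae (ae_of_all _ fun y => ?_)
      simp only
      rw [← symNorm_mul_symDensity μ hr hd hdτ x y]
      ring
    rw [h1]
    have hτ0 := hτ.pos x
    have hh0 := hh.pos x
    have hn0 : 0 < symNorm μ r d x := zero_lt_one.trans_le (hn1 x)
    have h2 : ∫ y in B, symDensity μ r d x y * h y ∂μ ≤ h x - c * τ x * h x := by
      linarith [hsuper x hx]
    have h3 : 0 ≤ symNorm μ r d x * (τ x)⁻¹ * (f x * f x) * (h x)⁻¹ :=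
      mul_nonneg (mul_nonneg (by positivity) (mul_self_nonneg _)) (by positivity)
    refine (mul_le_mul_of_nonneg_left h2 h3).trans (le_of_eq ?_)
    field_simp
  rw [integral_sub hnτff (hnff.const_mul c), integral_const_mul] at hground
  rw [inner_generator hr hd hτ hdτ hB hT, ← real_inner_self_eq_norm_sq,
    inner_speedMeasure hr hd hB]
  linarith

theorem nontrivial_lp_speedMeasure (hr : 0 < r) (hd : Regular d) (hB : μ B ≠ 0) :
    Nontrivial (Lp ℝ 2 (speedMeasure μ r d B)) := by
  have := isFiniteMeasure_speedMeasure (μ := μ) (B := B) hr hd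
  refine ⟨⟨(memLp_const (1 : ℝ)).toLp _, 0, fun h0 => hB ?_⟩⟩
  have h1 := (memLp_const (p := 2) (μ := speedMeasure μ r d B) (1 : ℝ)).coeFn_toLp
  rw [h0] at h1
  have h2 : ∀ᵐ x ∂μ.restrict B, False := by
    refine (Measure.absolutelyContinuous_of_le (restrict_le_speedMeasure hr hd)).ae_le ?_
    filter_upwards [h1, Lp.coeFn_zero ℝ 2 (speedMeasure μ r d B)] with x hx hx0
    rw [hx0] at hx
    simp at hx
  simpa using h2

theorem le_sInf_spectrum_of_supersolution (hr : 0 < r) (hd : Regular d) (hτ : Regular τ)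
    (hdτ : ∀ x, d x = vol μ r x * τ x) (hB : MeasurableSet B) (hB0 : μ B ≠ 0)
    {T : Lp ℝ 2 (speedMeasure μ r d B) →L[ℝ] Lp ℝ 2 (speedMeasure μ r d B)}
    (hT : ∀ f, T f =ᵐ[speedMeasure μ r d B]
      fun x => (τ x)⁻¹ * (f x - ∫ y in B, symDensity μ r d x y * f y ∂μ))
    {h : X → ℝ} (hh : Regular h) {c : ℝ}
    (hsuper : ∀ x ∈ B, c * τ x * h x + ∫ y in B, symDensity μ r d x y * h y ∂μ ≤ h x) :
    c ≤ sInf (spectrum ℝ T) := by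
  have := nontrivial_lp_speedMeasure hr hd hB0
  exact le_sInf_spectrum (generator_symm hr hd hτ hdτ hB hT)
    (le_inner_of_supersolution hr hd hτ hdτ hB hT hh hsuper)

end Form

section ExitBounds

variable {X : Type*} [MetricSpace X] [CompactSpace X] [MeasurableSpace X] [BorelSpace X]
variable {μ : Measure X} [IsFiniteMeasure μ] [μ.IsOpenPosMeasure] {r : ℝ} {d τ : X → ℝ} {B : Set X}

theorem killedOp_jumpKernel (hr : 0 < r) (hd : Regular d) (hB : MeasurableSet B) {g : X → ℝ≥0∞}
    (hg : Measurable g) (x : X) :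
    killedOp (jumpKernel μ r d) B g x =
      ∫⁻ y in B, ENNReal.ofReal (symDensity μ r d x y) * g y ∂μ := by
  have hm := (symDensity_facts μ hr hd).1.ennreal_ofReal
  rw [killedOp, jumpKernel, Kernel.withDensity_apply _ hm, Kernel.const_apply,
    restrict_withDensity hB]
  exact lintegral_withDensity_eq_lintegral_mul _ (hm.comp measurable_prodMk_left) hg

theorem holdJumpKernel_apply (hr : 0 < r) (hd : Regular d) (hτ : Regular τ) (s : ℝ × X) :
    holdJumpKernel μ r d τ s =
      ((volume : Measure ℝ).withDensity (exponentialPDF (τ s.2)⁻¹)).prod (jumpKernel μ r d s.2) := by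
  have hm := (symDensity_facts μ hr hd).1.ennreal_ofReal
  have he : Measurable (fun p : ℝ × ℝ => exponentialPDF p.1 p.2) := by
    simp only [exponentialPDF_eq]
    refine Measurable.ennreal_ofReal (Measurable.ite ?_ ?_ measurable_const)
    · exact measurableSet_le measurable_const measurable_snd
    · fun_prop
  have hm' : Measurable (Function.uncurry fun (s : ℝ × X) (z : ℝ × X) =>
      exponentialPDF (τ s.2)⁻¹ z.1 * ENNReal.ofReal (symDensity μ r d s.2 z.2)) := by
    have hτm := hτ.measurable
    have hF : Measurable fun q : (ℝ × X) × (ℝ × X) => ((τ q.1.2)⁻¹, q.2.1) := by fun_prop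
    have hG : Measurable fun q : (ℝ × X) × (ℝ × X) => (q.1.2, q.2.2) := by fun_prop
    have h1 := he.comp hF
    have h2 := hm.comp hG
    exact h1.mul h2
  rw [holdJumpKernel, jumpKernel, Kernel.withDensity_apply _ hm', Kernel.withDensity_apply _ hm,
    Kernel.const_apply, Kernel.const_apply]
  exact (prod_withDensity₀ (he.comp measurable_prodMk_left).aemeasurable
    (hm.comp measurable_prodMk_left).aemeasurable).symm

theorem isProbabilityMeasure_exponential {a : ℝ} (ha : 0 < a) :
    IsProbabilityMeasure ((volume : Measure ℝ).withDensity (exponentialPDF a)) :=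
  ⟨by rw [withDensity_apply _ MeasurableSet.univ, Measure.restrict_univ,
    lintegral_exponentialPDF_eq_one ha]⟩

theorem measurable_exponentialPDF (a : ℝ) : Measurable (exponentialPDF a) :=
  (measurable_exponentialPDFReal a).ennreal_ofReal

/-- The mean of the exponential law. -/
theorem lintegral_ofReal_exponential {a : ℝ} (ha : 0 < a) :
    ∫⁻ t, ENNReal.ofReal t ∂(volume : Measure ℝ).withDensity (exponentialPDF a) =
      ENNReal.ofReal a⁻¹ := by
  have h : ∀ t, (exponentialPDF a * fun t => ENNReal.ofReal t) t =
      ENNReal.ofReal a⁻¹ * gammaPDF 2 a t := by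
    intro t
    rw [Pi.mul_apply, exponentialPDF_eq, gammaPDF_eq]
    split_ifs with ht
    · rw [← ENNReal.ofReal_mul (by positivity), ← ENNReal.ofReal_mul (by positivity)]
      congr 1
      have h2 : (2 : ℝ) - 1 = 1 := by norm_num
      rw [Real.Gamma_two, h2, Real.rpow_one, Real.rpow_two]
      field_simp
    · simp
  rw [lintegral_withDensity_eq_lintegral_mul _ (measurable_exponentialPDF a)
    ENNReal.measurable_ofReal, lintegral_congr h, lintegral_const_mul' _ _ ENNReal.ofReal_ne_top,
    lintegral_gammaPDF_eq_one two_pos ha, mul_one]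

theorem lintegral_waiting (hr : 0 < r) (hd : Regular d) (hτ : Regular τ) (s : ℝ × X) :
    ∫⁻ z, ENNReal.ofReal z.1 ∂holdJumpKernel μ r d τ s = ENNReal.ofReal (τ s.2) := by
  have := isProbabilityMeasure_exponential (inv_pos.2 (hτ.pos s.2))
  have := isMarkovKernel_jump μ hr hd
  rw [holdJumpKernel_apply hr hd hτ, lintegral_prod _ (by fun_prop)]
  simp [lintegral_ofReal_exponential (inv_pos.2 (hτ.pos s.2))]

theorem holdJumpKernel_neg (hr : 0 < r) (hd : Regular d) (hτ : Regular τ) (s : ℝ × X) :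
    holdJumpKernel μ r d τ s {z | z.1 < 0} = 0 := by
  have := isProbabilityMeasure_exponential (inv_pos.2 (hτ.pos s.2))
  have := isMarkovKernel_jump μ hr hd
  have h1 : {z : ℝ × X | z.1 < 0} = Iio 0 ×ˢ univ := by
    ext
    simp
  rw [holdJumpKernel_apply hr hd hτ, h1, Measure.prod_prod, withDensity_apply _ measurableSet_Iio,
    lintegral_exponentialPDF_of_nonpos le_rfl, zero_mul]

theorem killedOp_holdJumpKernel (hr : 0 < r) (hd : Regular d) (hτ : Regular τ)
    (hB : MeasurableSet B) {g : X → ℝ≥0∞} (hg : Measurable g) :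
    killedOp (holdJumpKernel μ r d τ) (Prod.snd ⁻¹' B) (g ∘ Prod.snd) =
      killedOp (jumpKernel μ r d) B g ∘ Prod.snd := by
  funext s
  have := isProbabilityMeasure_exponential (inv_pos.2 (hτ.pos s.2))
  have := isMarkovKernel_jump μ hr hd
  rw [killedOp, ← lintegral_indicator (measurable_snd hB), holdJumpKernel_apply hr hd hτ]
  have h1 : (Prod.snd ⁻¹' B).indicator (g ∘ Prod.snd) =
      fun z : ℝ × X => B.indicator g z.2 := rfl
  have h2 : Measurable fun z : ℝ × X => B.indicator g z.2 := (hg.indicator hB).comp measurable_snd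
  rw [h1, lintegral_prod _ h2.aemeasurable]
  simp [lintegral_indicator hB, killedOp]

theorem green_holdJumpKernel (hr : 0 < r) (hd : Regular d) (hτ : Regular τ)
    (hB : MeasurableSet B) {g : X → ℝ≥0∞} (hg : Measurable g) :
    green (holdJumpKernel μ r d τ) (Prod.snd ⁻¹' B) (g ∘ Prod.snd) =
      green (jumpKernel μ r d) B g ∘ Prod.snd := by
  have h : ∀ k, (killedOp (holdJumpKernel μ r d τ) (Prod.snd ⁻¹' B))^[k] (g ∘ Prod.snd) =
      (killedOp (jumpKernel μ r d) B)^[k] g ∘ Prod.snd := by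
    intro k
    induction k with
    | zero => rfl
    | succ k ih =>
      rw [Function.iterate_succ_apply', Function.iterate_succ_apply', ih,
        killedOp_holdJumpKernel hr hd hτ hB (measurable_killedOp_iterate _ hB hg k)]
  funext s
  simp only [green, h, Function.comp_apply]

theorem green_le_meanExitSteps (hr : 0 < r) (hB : MeasurableSet B) {x : X} (hx : x ∈ B) :
    green (jumpKernel μ r (vol μ r)) B (fun _ => 1) x ≤ meanExitSteps μ r B x := by
  have := isMarkovKernel_jump μ hr (regular_vol μ hr)
  have h := green_le_lintegral (markovPart (jumpKernel μ r (vol μ r))) hB (h := fun _ => 1)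
    measurable_const hx (T := exitStep B)
    (ae_of_all _ fun ω => tsum_stayIn_le_exitStep B ω)
  simp only [lintegral_const, measure_univ, mul_one] at h
  rw [meanExitSteps]
  convert h
  exact (markovPart_eq _).symm

theorem green_le_meanExitTime (hβ : ∀ x, timeExponent μ x < ∞) (hr : 0 < r)
    (hB : MeasurableSet B) {x : X} (hx : x ∈ B) :
    green (jumpKernel μ r (dWeight μ r)) B (fun y => ENNReal.ofReal (waitingTime μ r y)) x ≤
      meanExitTime μ r B x := by
  have hd := regular_dWeight μ hβ hr
  have hτ := regular_waitingTime μ hβ hr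
  have hM := isMarkovKernel_holdJump μ hr hd hτ
  have hκ := markovPart_eq (holdJumpKernel μ r (dWeight μ r) (waitingTime μ r))
  have hN : MeasurableSet {z : ℝ × X | z.1 < 0} := measurableSet_lt measurable_fst measurable_const
  have hB' : MeasurableSet (Prod.snd ⁻¹' B : Set (ℝ × X)) := measurable_snd hB
  have h := green_le_lintegral (markovPart (holdJumpKernel μ r (dWeight μ r) (waitingTime μ r)))
    hB' (h := fun z => ENNReal.ofReal z.1) (by fun_prop) (s := (0, x)) hx (T := exitTime B) (by
      filter_upwards [ae_pathLaw_succ _ hN (fun s => by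
          rw [hκ]
          exact holdJumpKernel_neg hr hd hτ s) (0, x),
        ae_pathLaw_zero _ hB'.compl (s := (0, x)) (fun h => h hx)] with ω h1 h2
      exact tsum_stayIn_le_exitTime (not_not.1 h2) fun k => not_lt.1 (h1 k))
  rw [meanExitTime]
  refine le_trans (le_of_eq ?_) h
  rw [hκ]
  simp only [lintegral_waiting hr hd hτ]
  exact (congrFun (green_holdJumpKernel hr hd hτ hB hτ.measurable.ennreal_ofReal) (0, x)).symm

/-- A bound of the Green function gives a spectral gap. -/
theorem inv_le_sInf_spectrum_of_green_le (hr : 0 < r) (hd : Regular d) (hτ : Regular τ)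
    (hdτ : ∀ x, d x = vol μ r x * τ x) (hB : MeasurableSet B) (hB0 : μ B ≠ 0)
    {T : Lp ℝ 2 (speedMeasure μ r d B) →L[ℝ] Lp ℝ 2 (speedMeasure μ r d B)}
    (hT : ∀ f, T f =ᵐ[speedMeasure μ r d B]
      fun x => (τ x)⁻¹ * (f x - ∫ y in B, symDensity μ r d x y * f y ∂μ))
    {M : ℝ} (hM : 0 < M)
    (hG : ∀ x ∈ B, green (jumpKernel μ r d) B (fun y => ENNReal.ofReal (τ y)) x ≤
      ENNReal.ofReal M) : M⁻¹ ≤ sInf (spectrum ℝ T) := by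
  obtain ⟨hpm, hp0, -, -⟩ := symDensity_facts μ hr hd
  set G := green (jumpKernel μ r d) B (fun y => ENNReal.ofReal (τ y)) with hGdef
  have hGm : Measurable G := measurable_green _ hB hτ.measurable.ennreal_ofReal
  have hGeq : ∀ x, G x = ENNReal.ofReal (τ x) +
      ∫⁻ y in B, ENNReal.ofReal (symDensity μ r d x y) * G y ∂μ := fun x => by
    rw [hGdef, green_eq _ hB hτ.measurable.ennreal_ofReal, ← hGdef,
      killedOp_jumpKernel hr hd hB hGm]
  have hPG : ∀ x, ∫⁻ y in B, ENNReal.ofReal (symDensity μ r d x y) * G y ∂μ ≤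
      ENNReal.ofReal M := fun x => by
    have hpx : Measurable fun y => ENNReal.ofReal (symDensity μ r d x y) :=
      (hpm.comp measurable_prodMk_left).ennreal_ofReal
    calc _ ≤ ∫⁻ y in B, ENNReal.ofReal (symDensity μ r d x y) * ENNReal.ofReal M ∂μ :=
          setLIntegral_mono (hpx.mul_const _) fun y hy => by
            gcongr
            exact hG y hy
      _ ≤ ∫⁻ y, ENNReal.ofReal (symDensity μ r d x y) * ENNReal.ofReal M ∂μ :=
          setLIntegral_le_lintegral _ _
      _ = ENNReal.ofReal M := by
          rw [lintegral_mul_const _ hpx, lintegral_symDensity μ hr hd, one_mul]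
  have hfin : ∀ x, G x ≠ ∞ := fun x => by
    rw [hGeq]
    exact ENNReal.add_ne_top.2 ⟨ENNReal.ofReal_ne_top, ne_top_of_le_ne_top ENNReal.ofReal_ne_top
      (hPG x)⟩
  have hreal : ∀ x, (G x).toReal = τ x + ∫ y in B, symDensity μ r d x y * (G y).toReal ∂μ := by
    intro x
    have h1 : ∫ y in B, symDensity μ r d x y * (G y).toReal ∂μ =
        (∫⁻ y in B, ENNReal.ofReal (symDensity μ r d x y) * G y ∂μ).toReal := by
      rw [← integral_toReal]
      · refine integral_congr_ae (ae_of_all _ fun y => ?_)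
        simp only
        rw [ENNReal.toReal_mul, ENNReal.toReal_ofReal (hp0 x y)]
      · exact ((hpm.comp measurable_prodMk_left).ennreal_ofReal.mul hGm).aemeasurable
      · exact ae_of_all _ fun y => ENNReal.mul_lt_top ENNReal.ofReal_lt_top (hfin y).lt_top
    rw [h1, hGeq x, ENNReal.toReal_add ENNReal.ofReal_ne_top
      (ne_top_of_le_ne_top ENNReal.ofReal_ne_top (hPG x)), ENNReal.toReal_ofReal (hτ.pos x).le]
  obtain ⟨a, b, ha, hab⟩ := hτ.bounds
  have hh : Regular fun x => (G x).toReal := by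
    refine ⟨hGm.ennreal_toReal, a, b + M, ha, fun x => ⟨?_, ?_⟩⟩
    · rw [hreal x]
      have h0 : 0 ≤ ∫ y in B, symDensity μ r d x y * (G y).toReal ∂μ :=
        integral_nonneg fun y => mul_nonneg (hp0 x y) ENNReal.toReal_nonneg
      linarith [(hab x).1]
    · refine ENNReal.toReal_le_of_le_ofReal (by linarith [hτ.pos x, (hab x).2]) ?_
      rw [hGeq x, ENNReal.ofReal_add ((hτ.pos x).le.trans (hab x).2) hM.le]
      exact add_le_add (ENNReal.ofReal_le_ofReal (hab x).2) (hPG x)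
  refine le_sInf_spectrum_of_supersolution hr hd hτ hdτ hB hB0 hT hh fun x hx => ?_
  have h1 : (G x).toReal ≤ M := ENNReal.toReal_le_of_le_ofReal hM.le (hG x hx)
  have h2 : M⁻¹ * τ x * (G x).toReal ≤ τ x := by
    calc M⁻¹ * τ x * (G x).toReal ≤ M⁻¹ * τ x * M :=
          mul_le_mul_of_nonneg_left h1 (mul_nonneg (inv_nonneg.2 hM.le) (hτ.pos x).le)
      _ = τ x := by field_simp
  rw [hreal x] at h2 ⊢
  linarith

omit [MetricSpace X] [CompactSpace X] [BorelSpace X] in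
theorem regular_one : Regular fun _ : X => (1 : ℝ) :=
  ⟨measurable_const, 1, 1, one_pos, fun _ => ⟨le_rfl, le_rfl⟩⟩

theorem zero_le_sInf_spectrum (hr : 0 < r) (hd : Regular d) (hτ : Regular τ)
    (hdτ : ∀ x, d x = vol μ r x * τ x) (hB : MeasurableSet B) (hB0 : μ B ≠ 0)
    {T : Lp ℝ 2 (speedMeasure μ r d B) →L[ℝ] Lp ℝ 2 (speedMeasure μ r d B)}
    (hT : ∀ f, T f =ᵐ[speedMeasure μ r d B]
      fun x => (τ x)⁻¹ * (f x - ∫ y in B, symDensity μ r d x y * f y ∂μ)) :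
    0 ≤ sInf (spectrum ℝ T) := by
  refine le_sInf_spectrum_of_supersolution hr hd hτ hdτ hB hB0 hT (h := fun _ => 1)
    regular_one fun x _ => ?_
  obtain ⟨hpm, hp0, ⟨C, hC⟩, hp1⟩ := symDensity_facts μ hr hd
  have hint : Integrable (symDensity μ r d x) μ :=
    Integrable.of_bound (C := C) (hpm.comp measurable_prodMk_left).aestronglyMeasurable
      (ae_of_all _ fun y => by
        rw [Real.norm_eq_abs, abs_of_nonneg (hp0 x y)]
        exact hC x y)
  simp only [zero_mul, mul_one, zero_add]
  exact (setIntegral_le_integral hint (ae_of_all _ (hp0 x))).trans (hp1 x).le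

theorem one_sub_killedWalk_ae (hr : 0 < r) (f : Lp ℝ 2 (speedMeasure μ r (vol μ r) B)) :
    (1 - killedWalk μ r B) f =ᵐ[speedMeasure μ r (vol μ r) B] fun x =>
      (1 : ℝ)⁻¹ * (f x - ∫ y in B, symDensity μ r (vol μ r) x y * f y ∂μ) := by
  filter_upwards [Lp.coeFn_sub f (killedWalk μ r B f), killedWalk_ae μ hr B f] with x h1 h2
  rw [inv_one, one_mul]
  exact h1.trans (congrArg (fun u => f x - u) h2)

end ExitBounds

end LocalWalk

theorem mainTheorem3 {X : Type*} [MetricSpace X] [CompactSpace X] [ConnectedSpace X] [Nontrivial X]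
    [MeasurableSpace X] [BorelSpace X] (μ : Measure X) [IsFiniteMeasure μ] [μ.IsOpenPosMeasure] :
    (∃ r₀ : ℝ, 0 < r₀ ∧ ∃ c : ℝ, 0 < c ∧
      ∀ (x₀ : X) (R : ℝ), 0 < R → R < Metric.diam (univ : Set X) / 2 →
      ∀ r : ℝ, 0 < r → r < r₀ →
        c / (LocalWalk.maxExitSteps μ r (Metric.closedBall x₀ R)).toReal ≤
          sInf (spectrum ℝ (1 - LocalWalk.killedWalk μ r (Metric.closedBall x₀ R)))) ∧
    (LocalWalk.TimeRegular μ →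
      ∃ c : ℝ, 0 < c ∧
      ∀ (x₀ : X) (R : ℝ), 0 < R → R < Metric.diam (univ : Set X) / 2 →
      ∃ r₀ : ℝ, 0 < r₀ ∧ ∀ r : ℝ, 0 < r → r < r₀ →
        c / R ^ LocalWalk.timeExponentReal μ x₀ ≤
          sInf (spectrum ℝ (LocalWalk.killedGenerator μ r (Metric.closedBall x₀ R)))) := by
  have hball : ∀ (x₀ : X) (R : ℝ), 0 < R → μ (Metric.closedBall x₀ R) ≠ 0 := fun x₀ R hR =>
    (Metric.measure_closedBall_pos μ x₀ hR).ne'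
  refine ⟨⟨1, one_pos, 1, one_pos, fun x₀ R hR _ r hr _ => ?_⟩, ?_⟩
  · set B := Metric.closedBall x₀ R
    have hB : MeasurableSet B := Metric.isClosed_closedBall.measurableSet
    have hd := LocalWalk.regular_vol μ hr
    have hdτ : ∀ x, LocalWalk.vol μ r x = LocalWalk.vol μ r x * 1 := fun x => (mul_one _).symm
    have hT := LocalWalk.one_sub_killedWalk_ae (μ := μ) (B := B) hr
    set M := LocalWalk.maxExitSteps μ r B
    rcases ENNReal.toReal_nonneg (a := M) |>.eq_or_lt with h0 | h0
    · rw [← h0, div_zero]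
      exact LocalWalk.zero_le_sInf_spectrum hr hd LocalWalk.regular_one hdτ hB (hball x₀ R hR) hT
    · rw [one_div]
      refine LocalWalk.inv_le_sInf_spectrum_of_green_le hr hd LocalWalk.regular_one hdτ hB
        (hball x₀ R hR) hT h0 fun x hx => ?_
      rw [ENNReal.ofReal_toReal (ENNReal.toReal_pos_iff.1 h0).2.ne, ENNReal.ofReal_one]
      exact (LocalWalk.green_le_meanExitSteps hr hB hx).trans
        (le_iSup₂ (f := fun y (_ : y ∈ B) => LocalWalk.meanExitSteps μ r B y) x hx)
  · rintro ⟨hβ, C, hC, hE⟩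
    refine ⟨(2 * C)⁻¹, by positivity, fun x₀ R hR hRd => ?_⟩
    set B := Metric.closedBall x₀ R
    have hB : MeasurableSet B := Metric.isClosed_closedBall.measurableSet
    have hRβ : 0 < R ^ LocalWalk.timeExponentReal μ x₀ := Real.rpow_pos_of_pos hR _
    set M := 2 * C * R ^ LocalWalk.timeExponentReal μ x₀
    have hM : 0 < M := by positivity
    have hlt : LocalWalk.limitExitTime μ B < ENNReal.ofReal M := by
      refine (hE x₀ R hR hRd).2.trans_lt ((ENNReal.ofReal_lt_ofReal_iff hM).2 ?_)
      linarith [mul_pos hC hRβ]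
    have hev := eventually_lt_of_limsup_lt hlt
    obtain ⟨r₀, hr₀, hr₀'⟩ := mem_nhdsGT_iff_exists_Ioo_subset.1 hev
    refine ⟨r₀, hr₀, fun r hr hrr => ?_⟩
    have hφ : LocalWalk.maxExitTime μ r B < ENNReal.ofReal M := hr₀' ⟨hr, hrr⟩
    rw [div_eq_mul_inv, ← mul_inv]
    refine LocalWalk.inv_le_sInf_spectrum_of_green_le hr (LocalWalk.regular_dWeight μ hβ hr)
      (LocalWalk.regular_waitingTime μ hβ hr) (fun _ => rfl) hB (hball x₀ R hR)
      (LocalWalk.killedGenerator_ae μ hβ hr B) hM fun x hx => ?_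
    exact ((LocalWalk.green_le_meanExitTime hβ hr hB hx).trans
      (le_iSup₂ (f := fun y (_ : y ∈ B) => LocalWalk.meanExitTime μ r B y) x hx)).trans hφ.le
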